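/- **Definitions.** Let $M\subset\mathbb R^n$ be an embedded $C^2$ hypersurface and $U\subset\mathbb R^n$ an open set with $U\cap(\overline M\setminus M)=\varnothing$. Let $f$ be a real-valued function of class $C^2$ near $M\cap U$, and let $\mathcal E_f(M)=\int_M f\,d\mathcal H_{n-1}$. Denote by $e_1,\dots,e_{n-1}$ an orthonormal basis of the tangent space of $M$ at a point, by $\mathbf B$ the second fundamental form of $M$, by $\mathbf H=\sum_i\mathbf B(e_i,e_i)$ its mean curvature vector, by $D$ the Euclidean derivative, and by $w^{\perp}$ the component of a vector $w$ normal to $M$. * $M$ is *$f$-stationary in $U$* if $\frac{d}{dt}\big|_{t=0}\mathcal E_f(\varphi_t(M\cap K))=0$ for every compact $K\subset U$ and every $C^2$ deformation $(\varphi_t)_{-\varepsilon<t<\varepsilon}$ of $M$ with $\varphi_0=\mathrm{id}$ and $\varphi_t=\mathrm{id}$ outside $K$. * $M$ is *$f$-stable in $U$* if it is $f$-stationary in $U$ and $$\int_M f\Big[\sum_{i,j=1}^{n-1}\langle \mathbf B(e_i,e_j),X\rangle^2+\langle\mathbf H,X\rangle^2\Big]d\mathcal H_{n-1}\;\le\;\int_M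 \Big[f\sum_{i=1}^{n-1}\big|(D_{e_i}X)^{\perp}\big|^2+\mathrm{Hess} f(X,X)\Big]d\mathcal H_{n-1}$$ for every $C^1$ field $X$ that is normal to $M$ and has compact support in $U$. * $M$ is *stable minimal in $U$* if this holds with $f\equiv 1$ (critical point of the area which satisfies the stability inequality). **Theorem 1.8 (Theorem 2.11).** Let $n\ge 2$ and let $h:(0,\infty)\to\mathbb R$ be of class $C^2$ with $$t\,(h'(t))^2+2t\,h''(t)+2n\,h'(t)\ge 0\quad\text{for all } t>0,\qquad \int_0^r e^{h(t)}\,t^{n-2}\,dt<\infty\quad\text{for all } r>0 .$$ Let $\mathcal C=C(\Sigma)=\{tx: t\ge 0,\ x\in\Sigma\}$, $\Sigma\subset S^{n-1}(1)$, be a cone in $\mathbb R^n$ such that $M=\mathcal C\setminus\{0\}$ is an orientable embedded $C^2$ hypersurface, and let $U\subset\mathbb R^n$ be open with $U\cap(\overline M\setminus M)=\varnothing$ (for compact $\Sigma\neq\varnothing$, one may take $U=\mathbb R^n\setminus\{0\}$). If $M$ is stable minimal in $U$, then $M$ is $f$-stable in $U$ for $f(x)=e^{h(|x|)}$. -/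

import Mathlib

open Set MeasureTheory
open scoped RealInnerProductSpace

noncomputable section

namespace WeightedArea

/-- Euclidean space `ℝⁿ`. -/
abbrev E (n : ℕ) : Type := EuclideanSpace ℝ (Fin n)

/-- The cone `{t x | t ≥ 0, x ∈ S}` over a set `S` (its link, when `S` lies in the unit sphere). -/
def cone {n : ℕ} (S : Set (E n)) : Set (E n) :=
  {y | ∃ t : ℝ, 0 ≤ t ∧ ∃ x ∈ S, y = t • x}

/-- `M` is an embedded hypersurface of class `C²`: near each of its points it is the zero set of
a `C²` function with nonvanishing differential. `M` need not be closed in `ℝⁿ`. -/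
def IsC2Hypersurface {n : ℕ} (M : Set (E n)) : Prop :=
  ∀ p ∈ M, ∃ V : Set (E n), IsOpen V ∧ p ∈ V ∧ ∃ F : E n → ℝ,
    ContDiffOn ℝ 2 F V ∧ (∀ x ∈ V, fderiv ℝ F x ≠ 0) ∧ M ∩ V = {x | x ∈ V ∧ F x = 0}

/-- The tangent space of `M` at `x`, as a linear subspace of `ℝⁿ`: it is spanned by the limits of
scaled secants `cₘ (xₘ - x)` with `xₘ ∈ M`, `xₘ → x`. -/
def tangentSpace {n : ℕ} (M : Set (E n)) (x : E n) : Submodule ℝ (E n) :=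
  Submodule.span ℝ (tangentConeAt ℝ M x)

/-- `M` is orientable: it carries a continuous unit normal field. -/
def IsOrientable {n : ℕ} (M : Set (E n)) : Prop :=
  ∃ ν : E n → E n, ContinuousOn ν M ∧ ∀ x ∈ M, ‖ν x‖ = 1 ∧ ν x ∈ (tangentSpace M x)ᗮ

/-- An orthonormal basis `e₁, …, eₖ` of the tangent space of `M` at `x`. All quantities formed with
it below are independent of its choice. -/
def tangentFrame {n : ℕ} (M : Set (E n)) (x : E n) :
    Fin (Module.finrank ℝ (tangentSpace M x)) → E n :=
  fun i => (stdOrthonormalBasis ℝ (tangentSpace M x) i : E n)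

/-- The component of the vector `w` normal to `M` at `x`. -/
def normalPart {n : ℕ} (M : Set (E n)) (x w : E n) : E n :=
  ((tangentSpace M x)ᗮ).starProjection w

/-- The second fundamental form `B(u, v) = (D_u V)^⊥` of `M` at `x`, for `u, v` tangent to `M` at
`x`. Here `V` is the tangential field `y ↦ (orthogonal projection of v to the tangent space at y)`,
which extends `v` along `M`, and it is differentiated along `M` in the tangent direction `u`. -/
def secondFundamentalForm {n : ℕ} (M : Set (E n)) (x u v : E n) : E n :=
  normalPart M x (fderivWithin ℝ (fun y => (tangentSpace M y).starProjection v) M x u)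

/-- The mean curvature vector `H = ∑ᵢ B(eᵢ, eᵢ)`. -/
def meanCurvature {n : ℕ} (M : Set (E n)) (x : E n) : E n :=
  ∑ i, secondFundamentalForm M x (tangentFrame M x i) (tangentFrame M x i)

/-- The Jacobian `√det(Lᵀ L)` at `x` of the restriction to `M` of a differentiable map `ψ`, where
`L` is the restriction of the differential of `ψ` to the tangent space of `M` at `x`. -/
def tangentialJacobian {n : ℕ} (M : Set (E n)) (ψ : E n → E n) (x : E n) : ℝ :=
  let L : tangentSpace M x →L[ℝ] E n := (fderiv ℝ ψ x).comp (tangentSpace M x).subtypeL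
  Real.sqrt (((ContinuousLinearMap.adjoint L).comp L).det)

/-- The `f`-weighted area of the image `ψ(A)` of a part `A` of the hypersurface `M`, i.e. the
integral of `f` over `ψ(A)` with respect to the `(n-1)`-dimensional Hausdorff measure, pulled back
to `M` (points of the image being counted with multiplicity). For `ψ = id` this is the integral
of `f` over `A`. -/
def weightedArea {n : ℕ} (f : E n → ℝ) (M A : Set (E n)) (ψ : E n → E n) : ℝ :=
  ∫ x in A, f (ψ x) * tangentialJacobian M ψ x ∂μHE[n - 1]

/-- `φ` is a deformation of class `C²`, `-ε < t < ε`, which fixes all points outside `K`. (Only the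
restrictions of the maps `φ t` to the surface matter; each compactly supported `C²` deformation of
an embedded surface extends to the ambient space.) -/
structure IsDeformation {n : ℕ} (K : Set (E n)) (ε : ℝ) (φ : ℝ → E n → E n) : Prop where
  contDiffOn : ContDiffOn ℝ 2 (fun p : ℝ × E n => φ p.1 p.2) (Ioo (-ε) ε ×ˢ univ)
  zero : ∀ x, φ 0 x = x
  fixed : ∀ t ∈ Ioo (-ε) ε, ∀ x, x ∉ K → φ t x = x

/-- `M` is `f`-stationary in the open set `U`: the first variation of the `f`-weighted area
vanishes for all deformations supported in a compact subset `K` of `U`. The part of `M` outside `K`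
does not move and is left out, since its weighted area may be infinite. -/
def IsFStationary {n : ℕ} (f : E n → ℝ) (M U : Set (E n)) : Prop :=
  ∀ (K : Set (E n)) (ε : ℝ) (φ : ℝ → E n → E n), IsCompact K → K ⊆ U → 0 < ε →
    IsDeformation K ε φ → HasDerivAt (fun t => weightedArea f M (M ∩ K) (φ t)) 0 0

/-- `X` is a normal variation field of `M` of class `C¹`, with compact support in `U`. -/
structure IsNormalVariation {n : ℕ} (M U : Set (E n)) (X : E n → E n) : Prop where
  contDiff : ContDiff ℝ 1 X
  hasCompactSupport : HasCompactSupport X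
  tsupport_subset : tsupport X ⊆ U
  normal : ∀ x ∈ M, X x ∈ (tangentSpace M x)ᗮ

/-- `M` is `f`-stable in `U`: it is `f`-stationary in `U`, and
`∫_M f (∑ᵢⱼ ⟨B(eᵢ, eⱼ), X⟩² + ⟨H, X⟩²) ≤ ∫_M f ∑ᵢ |(D_{eᵢ} X)^⊥|² + Hess f (X, X)`
for all compactly supported normal variation fields `X` in `U`. -/
structure IsFStable {n : ℕ} (f : E n → ℝ) (M U : Set (E n)) : Prop where
  stationary : IsFStationary f M U
  stability : ∀ X : E n → E n, IsNormalVariation M U X →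
    ∫ x in M, f x *
        ((∑ i, ∑ j, ⟪secondFundamentalForm M x (tangentFrame M x i) (tangentFrame M x j), X x⟫ ^ 2)
          + ⟪meanCurvature M x, X x⟫ ^ 2) ∂μHE[n - 1]
      ≤ ∫ x in M, (f x * (∑ i, ‖normalPart M x (fderiv ℝ X x (tangentFrame M x i))‖ ^ 2)
          + fderiv ℝ (fderiv ℝ f) x (X x) (X x)) ∂μHE[n - 1]

/-- A stable minimal hypersurface in `U`: a stationary point of the area functional (weight `1`)
which satisfies the stability inequality of the area functional. -/
def IsStableMinimal {n : ℕ} (M U : Set (E n)) : Prop :=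
  IsFStable (fun _ => (1 : ℝ)) M U

end WeightedArea

end

/-!
The proof compares the weighted variations of the cone `M` with its area variations, using that the
gradient of `f = exp (h |x|)` is radial and hence tangent to `M`.

*Stationarity.* The first variation formula (`IsDeformation.hasDerivAt_weightedArea`) says that a
deformation `φ` with initial velocity `Y` changes the weighted area at the rate
`∫ ⟨∇f, Y⟩ + f div_M Y`. As `∇f` is tangent to `M`, the integrand is `div_M (f Y)`, the rate of
change of the area under any deformation with velocity `f Y`. Such a deformation is
`(t, x) ↦ φ (t f(x)) x` (`IsDeformation.rescale`), which is again of class `C²` although `Y` is only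
`C¹`; so area stationarity gives `f`-stationarity (`IsFStationary.of_area`).

*Stability.* Insert the field `exp (h / 2) X` into the stability inequality for the area. The
curvature terms become the weighted ones, and since `∇ exp (h / 2)` is radial, the gradient term
becomes `f |∇^⊥ X|² + (f h' / r) ⟨D_x X, X⟩ + f h'² |X|² / 4` (`normalGradSq_smul`). On the other
side `Hess f (X, X) = (f h' / r) |X|²` because `X` is orthogonal to `x` (`hessian_weight_apply`).
The term with `⟨D_x X, X⟩` is integrated by parts in the radial direction: the identity
`∫_M (D_x φ + (n - 1) φ) = 0` (`integral_radial_deriv`) is the derivative at `1` of the scaling law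
of the Hausdorff measure on `M`, and is used with `φ = f h' |X|² / (2 r)`. What remains is
`f |X|² / (4 r)` times `r h'² + 2 r h'' + 2 n h' ≥ 0`.

For these computations `M` has to be locally of finite area and its tangent planes have to vary
continuously; both are read off from local defining functions. The Jacobian is written as the square
root of a determinant on the whole space, a polynomial in the differential and the projection to
the tangent plane (`tangentialJacobian_eq`), which makes the integrands `C¹` functions of time and
of a continuous quantity on `M`.
-/

noncomputable section

open Filter Topology

namespace WeightedArea

variable {n : ℕ} {M : Set (E n)}

/-! ### Tangent spaces and local area of a `C²` hypersurface -/

/-- Velocities of curves in `M` are tangent to `M`. -/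
lemma mem_tangentSpace_of_hasDerivAt {γ : ℝ → E n} {v : E n} (hγ : HasDerivAt γ v 0)
    (hM : ∀ᶠ t in 𝓝 (0 : ℝ), γ t ∈ M) : v ∈ tangentSpace M (γ 0) := by
  refine Submodule.subset_span
    (mem_tangentConeAt_of_seq (𝓝[≠] (0 : ℝ)) (fun t => t⁻¹) (fun t => γ t - γ 0) ?_ ?_ ?_)
  · have : Tendsto (fun t => γ t - γ 0) (𝓝 0) (𝓝 (γ 0 - γ 0)) :=
      hγ.continuousAt.tendsto.sub_const _
    rw [sub_self] at this
    exact this.mono_left nhdsWithin_le_nhds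
  · filter_upwards [nhdsWithin_le_nhds hM] with t ht
    simpa using ht
  · simpa using hγ.tendsto_slope_zero

/-- `F` is a `C²` function defining `M` in the open set `V`. -/
structure IsDefiningFunction (M V : Set (E n)) (F : E n → ℝ) : Prop where
  isOpen : IsOpen V
  contDiffOn : ContDiffOn ℝ 2 F V
  fderiv_ne_zero : ∀ x ∈ V, fderiv ℝ F x ≠ 0
  inter_eq : M ∩ V = {x | x ∈ V ∧ F x = 0}

lemma IsC2Hypersurface.exists_isDefiningFunction (hM : IsC2Hypersurface M) {p : E n}
    (hp : p ∈ M) : ∃ V, p ∈ V ∧ ∃ F, IsDefiningFunction M V F := by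
  obtain ⟨V, hV, hpV, F, h1, h2, h3⟩ := hM p hp
  exact ⟨V, hpV, F, hV, h1, h2, h3⟩

namespace IsDefiningFunction

variable {V : Set (E n)} {F : E n → ℝ} {x : E n}

lemma eq_zero (hF : IsDefiningFunction M V F) (hxM : x ∈ M) (hxV : x ∈ V) : F x = 0 :=
  (hF.inter_eq.subset ⟨hxM, hxV⟩).2

lemma mem_of_eq_zero (hF : IsDefiningFunction M V F) (hxV : x ∈ V) (h : F x = 0) : x ∈ M :=
  (hF.inter_eq.superset ⟨hxV, h⟩).1

lemma contDiffAt (hF : IsDefiningFunction M V F) (hxV : x ∈ V) : ContDiffAt ℝ 2 F x :=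
  hF.contDiffOn.contDiffAt (hF.isOpen.mem_nhds hxV)

lemma hasStrictFDerivAt (hF : IsDefiningFunction M V F) (hxV : x ∈ V) :
    HasStrictFDerivAt F (fderiv ℝ F x) x :=
  (hF.contDiffAt hxV).hasStrictFDerivAt (by norm_num)

/-- One inclusion holds because `F` vanishes on `M`; for the other the implicit function theorem
produces a curve in `M` with a given velocity in the kernel. -/
lemma tangentSpace_eq_ker (hF : IsDefiningFunction M V F) (hxM : x ∈ M) (hxV : x ∈ V) :
    tangentSpace M x = (fderiv ℝ F x).ker := by
  have hst := hF.hasStrictFDerivAt hxV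
  apply le_antisymm
  · refine Submodule.span_le.2 fun v hv => ?_
    rw [← tangentConeAt_inter_nhds (hF.isOpen.mem_nhds hxV), hF.inter_eq] at hv
    have h1 := hst.hasFDerivAt.hasFDerivWithinAt (s := {x | x ∈ V ∧ F x = 0}) |>.mapsTo_tangent_cone
      hv
    have h2 : F '' {x | x ∈ V ∧ F x = 0} ⊆ {0} := by
      rintro _ ⟨y, hy, rfl⟩
      exact hy.2
    have h3 := tangentConeAt_subset_zero (𝕜 := ℝ) (x := F x)
      (s := F '' {x | x ∈ V ∧ F x = 0}) (fun hacc => by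
        have h4 := hacc.mono (principal_mono.2 h2)
        rw [hF.eq_zero hxM hxV, accPt_iff_frequently] at h4
        obtain ⟨y, hy1, hy2⟩ := h4.exists
        exact hy1 hy2) h1
    simpa using h3
  · intro v hv
    have hr : (fderiv ℝ F x).range = ⊤ := by
      apply LinearMap.range_eq_top.2
      apply LinearMap.surjective
      intro h0
      exact hF.fderiv_ne_zero x hxV (ContinuousLinearMap.coe_injective h0)
    set g := hst.implicitFunction F (fderiv ℝ F x) hr with hg
    have hg0 : g (F x) 0 = x := hst.implicitFunction_apply_image hr
    have hgd : HasStrictFDerivAt (g (F x)) (fderiv ℝ F x).ker.subtypeL 0 :=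
      hst.to_implicitFunction hr
    have hev : ∀ᶠ p : ℝ × (fderiv ℝ F x).ker in 𝓝 (F x, 0), F (g p.1 p.2) = p.1 :=
      hst.map_implicitFunction_eq hr
    let w : (fderiv ℝ F x).ker := ⟨v, hv⟩
    have hlin : HasDerivAt (fun t : ℝ => t • w) w 0 := by
      simpa using (hasDerivAt_id (0 : ℝ)).smul_const w
    have hγ : HasDerivAt (fun t : ℝ => g (F x) (t • w)) v 0 := by
      have h0 : HasFDerivAt (g (F x)) (fderiv ℝ F x).ker.subtypeL ((0 : ℝ) • w) := by
        rw [zero_smul]; exact hgd.hasFDerivAt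
      exact h0.comp_hasDerivAt (0 : ℝ) hlin
    have hγ0 : g (F x) ((0 : ℝ) • w) = x := by rw [zero_smul, hg0]
    have := mem_tangentSpace_of_hasDerivAt (M := M) hγ ?_
    · rwa [hγ0] at this
    · have hc := hγ.continuousAt
      have hV : ∀ᶠ t in 𝓝 (0 : ℝ), g (F x) (t • w) ∈ V := by
        apply hc.eventually_mem
        rw [hγ0]; exact hF.isOpen.mem_nhds hxV
      have hT : Tendsto (fun t : ℝ => (F x, t • w)) (𝓝 0) (𝓝 (F x, 0)) := by
        have : ContinuousAt (fun t : ℝ => (F x, t • w)) 0 := by fun_prop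
        simpa [ContinuousAt] using this
      filter_upwards [hV, hT.eventually hev] with t h1 h2
      exact hF.mem_of_eq_zero h1 (h2.trans (hF.eq_zero hxM hxV))

lemma tangentSpace_eq_orthogonal (hF : IsDefiningFunction M V F) (hxM : x ∈ M) (hxV : x ∈ V) :
    tangentSpace M x = (ℝ ∙ gradient F x)ᗮ := by
  ext v
  rw [hF.tangentSpace_eq_ker hxM hxV, Submodule.mem_orthogonal_singleton_iff_inner_right]
  simp [gradient]

lemma gradient_ne_zero (hF : IsDefiningFunction M V F) (hxV : x ∈ V) : gradient F x ≠ 0 := by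
  simpa [gradient] using hF.fderiv_ne_zero x hxV

end IsDefiningFunction

lemma starProjection_orthogonal_singleton (v : E n) :
    ((ℝ ∙ v)ᗮ).starProjection
      = ContinuousLinearMap.id ℝ (E n) - (‖v‖ ^ 2)⁻¹ • (innerSL ℝ v).smulRight v := by
  ext1 w
  rw [Submodule.starProjection_orthogonal_val]
  simp [Submodule.starProjection_singleton, smul_smul, div_eq_inv_mul]

/-- The tangent planes of a `C²` hypersurface vary continuously. -/
lemma IsC2Hypersurface.continuousOn_starProjection (hM : IsC2Hypersurface M) :
    ContinuousOn (fun x => (tangentSpace M x).starProjection) M := by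
  intro p hp
  obtain ⟨V, hpV, F, hF⟩ := hM.exists_isDefiningFunction hp
  have hV := hF.isOpen.mem_nhds hpV
  have hgc : ContinuousAt (gradient F) p := by
    have h1 : ContinuousAt (fderiv ℝ F) p :=
      ((hF.contDiffAt hpV).fderiv_right (m := 1) (by norm_num)).continuousAt
    exact (InnerProductSpace.toDual ℝ (E n)).symm.continuous.continuousAt.comp h1
  have hc : ContinuousAt (fun x => ContinuousLinearMap.id ℝ (E n)
      - (‖gradient F x‖ ^ 2)⁻¹ • (innerSL ℝ (gradient F x)).smulRight (gradient F x)) p := by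
    have h0 : ‖gradient F p‖ ^ 2 ≠ 0 := by simpa using hF.gradient_ne_zero hpV
    have h2 : ContinuousAt (fun x => (innerSL ℝ (gradient F x)).smulRight (gradient F x)) p := by
      have : ContinuousAt (fun x => innerSL ℝ (gradient F x)) p :=
        (innerSL ℝ).continuous.continuousAt.comp hgc
      exact ((ContinuousLinearMap.smulRightL ℝ (E n) (E n)).continuous.continuousAt.comp
        this).clm_apply hgc
    exact continuousAt_const.sub (((hgc.norm.pow 2).inv₀ h0).smul h2)
  refine hc.continuousWithinAt.congr_of_eventuallyEq ?_ ?_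
  · filter_upwards [self_mem_nhdsWithin, nhdsWithin_le_nhds hV] with x hxM hxV
    simp only [hF.tangentSpace_eq_orthogonal hxM hxV, starProjection_orthogonal_singleton]
  · simp only [hF.tangentSpace_eq_orthogonal hp hpV, starProjection_orthogonal_singleton]

lemma IsC2Hypersurface.isLocallyClosed (hM : IsC2Hypersurface M) : IsLocallyClosed M := by
  apply ((isLocallyClosed_tfae M).out 0 3).2
  intro p hp
  obtain ⟨V, hpV, F, hF⟩ := hM.exists_isDefiningFunction hp
  refine ⟨V, hpV, hF.isOpen, ?_⟩
  rintro x ⟨hxV, hxc⟩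
  apply hF.mem_of_eq_zero hxV
  have h1 : x ∈ closure (M ∩ V) := by
    rw [inter_comm]; exact hF.isOpen.inter_closure ⟨hxV, hxc⟩
  have hc : ContinuousWithinAt F (M ∩ V) x :=
    (hF.contDiffAt hxV).continuousAt.continuousWithinAt
  have := hc.mem_closure_image h1
  have h2 : F '' (M ∩ V) ⊆ {0} := by
    rintro _ ⟨y, hy, rfl⟩
    exact hF.eq_zero hy.1 hy.2
  simpa using closure_mono h2 this

lemma IsC2Hypersurface.measurableSet (hM : IsC2Hypersurface M) : MeasurableSet M :=
  let ⟨_, _, hU, hZ, h⟩ := hM.isLocallyClosed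
  h ▸ hU.measurableSet.inter hZ.measurableSet

/-- A vector that is at most `1 / 2` of its length away from `vᗮ` is controlled by its projection
to `vᗮ`. -/
lemma norm_le_two_mul_norm_orthogonalProjectionOnto {v z : E n} (hv : v ≠ 0)
    (h : |⟪v, z⟫| ≤ ‖v‖ / 2 * ‖z‖) : ‖z‖ ≤ 2 * ‖((ℝ ∙ v)ᗮ).orthogonalProjectionOnto z‖ := by
  have hv' : 0 < ‖v‖ := norm_pos_iff.2 hv
  have h1 := Submodule.norm_sq_eq_add_norm_sq_starProjection z (ℝ ∙ v)
  have h2 : ‖(ℝ ∙ v).starProjection z‖ = |⟪v, z⟫| / ‖v‖ := by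
    rw [Submodule.starProjection_singleton, norm_smul]
    simp only [Real.norm_eq_abs, abs_div, RCLike.ofReal_real_eq_id, id, abs_pow, abs_norm]
    field_simp
  have h3 : ‖(ℝ ∙ v).starProjection z‖ ≤ ‖z‖ / 2 := by
    rw [h2, div_le_iff₀ hv']; linarith
  have h4 : ‖((ℝ ∙ v)ᗮ).orthogonalProjectionOnto z‖ = ‖((ℝ ∙ v)ᗮ).starProjection z‖ := rfl
  rw [h4]
  nlinarith [norm_nonneg ((ℝ ∙ v).starProjection z), norm_nonneg ((ℝ ∙ v)ᗮ.starProjection z),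
    norm_nonneg z]

/-- Near each of its points, `M` is the graph of a Lipschitz function over a piece of the tangent
plane: the orthogonal projection to that plane does not shrink secants by more than a factor `2`. -/
lemma IsC2Hypersurface.exists_nhds_measure_lt_top (hM : IsC2Hypersurface M) {p : E n}
    (hp : p ∈ M) : ∃ W ∈ 𝓝 p, (μHE[n - 1] : Measure (E n)) (M ∩ W) < ⊤ := by
  obtain ⟨V, hpV, F, hF⟩ := hM.exists_isDefiningFunction hp
  have hg0 := hF.gradient_ne_zero hpV
  set g := gradient F p with hg
  have hgpos : 0 < ‖g‖ / 2 := half_pos (norm_pos_iff.2 hg0)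
  have hst := (hF.hasStrictFDerivAt hpV).isLittleO.def hgpos
  rw [nhds_prod_eq] at hst
  obtain ⟨W₀, hW₀, hlip⟩ := eventually_prod_self_iff'.1 hst
  refine ⟨W₀ ∩ V ∩ Metric.ball p 1, inter_mem (inter_mem hW₀ (hF.isOpen.mem_nhds hpV))
    (Metric.ball_mem_nhds p one_pos), ?_⟩
  set A := M ∩ (W₀ ∩ V ∩ Metric.ball p 1) with hA
  let T := (ℝ ∙ g)ᗮ
  let π : A → T := fun x => T.orthogonalProjectionOnto (x : E n)
  have hanti : AntilipschitzWith 2 π := by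
    apply AntilipschitzWith.of_le_mul_dist
    rintro ⟨x, hxM, ⟨hxW, hxV⟩, -⟩ ⟨y, hyM, ⟨hyW, hyV⟩, -⟩
    -- `F` vanishes at both ends of the secant, so its differential at `p` is small on the secant
    have h1 := hlip x hxW y hyW
    simp only [hF.eq_zero hxM hxV, hF.eq_zero hyM hyV, sub_self, zero_sub, norm_neg] at h1
    have h2 : fderiv ℝ F p (x - y) = ⟪g, x - y⟫ := by simp [hg, gradient]
    rw [h2] at h1
    have h3 := norm_le_two_mul_norm_orthogonalProjectionOnto hg0 h1
    simpa [Subtype.dist_eq, dist_eq_norm, π, T, map_sub] using h3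
  have hbdd : Bornology.IsBounded (range π) := by
    have h1 : range π ⊆ T.orthogonalProjectionOnto '' Metric.ball p 1 := by
      rintro _ ⟨x, rfl⟩
      exact ⟨x, x.2.2.2, rfl⟩
    exact (T.orthogonalProjectionOnto.lipschitz.isBounded_image Metric.isBounded_ball).subset h1
  have hdim : Module.finrank ℝ T = n - 1 := by
    have h1 := Submodule.finrank_add_finrank_orthogonal (ℝ ∙ g)
    rw [finrank_span_singleton hg0, finrank_euclideanSpace_fin] at h1
    have : Module.finrank ℝ T = Module.finrank ℝ (ℝ ∙ g)ᗮ := rfl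
    omega
  have hfin : (μH[(n - 1 : ℕ)] : Measure T) (range π) < ⊤ := by
    rw [← hdim]
    exact hbdd.measure_lt_top
  have h1 : (μH[(n - 1 : ℕ)] : Measure (E n)) A ≤ (2 : NNReal) ^ ((n - 1 : ℕ) : ℝ)
      * (μH[(n - 1 : ℕ)] : Measure T) (range π) := by
    have h2 := hanti.le_hausdorffMeasure_image (Nat.cast_nonneg (n - 1)) univ
    have h3 := (isometry_subtype_coe (s := A)).hausdorffMeasure_image
      (Or.inl (Nat.cast_nonneg (n - 1))) univ
    rw [image_univ, Subtype.range_coe] at h3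
    rw [h3, ← image_univ]
    exact h2
  rw [Measure.euclideanHausdorffMeasure_def, Measure.smul_apply, ENNReal.smul_def, smul_eq_mul]
  refine ENNReal.mul_lt_top ENNReal.coe_lt_top (h1.trans_lt (ENNReal.mul_lt_top ?_ hfin))
  exact ENNReal.rpow_lt_top_of_nonneg (Nat.cast_nonneg _) ENNReal.coe_ne_top

/-- The part of `M` in a compact subset of `U` is compact, as `M` is relatively closed in `U`. -/
lemma isCompact_inter {K U : Set (E n)} (hU : Disjoint U (closure M \ M)) (hK : IsCompact K)
    (hKU : K ⊆ U) : IsCompact (M ∩ K) := by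
  have : M ∩ K = closure M ∩ K := by
    refine Subset.antisymm (inter_subset_inter_left _ subset_closure) fun x hx => ⟨?_, hx.2⟩
    by_contra hxM
    exact hU.le_bot ⟨hKU hx.2, hx.1, hxM⟩
  rw [this]
  exact hK.inter_left isClosed_closure

lemma IsC2Hypersurface.measure_lt_top_of_isCompact (hM : IsC2Hypersurface M) {A : Set (E n)}
    (hA : IsCompact A) (hAM : A ⊆ M) : (μHE[n - 1] : Measure (E n)) A < ⊤ := by
  refine hA.induction_on (p := fun s => (μHE[n - 1] : Measure (E n)) s < ⊤) (by simp)
    (fun s t hst ht => (measure_mono hst).trans_lt ht) (fun s t hs ht => measure_union_lt_top hs ht)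
    fun x hx => ?_
  obtain ⟨W, hW, hfin⟩ := hM.exists_nhds_measure_lt_top (hAM hx)
  exact ⟨A ∩ W, inter_mem_nhdsWithin A hW,
    (measure_mono (inter_subset_inter_left W hAM)).trans_lt hfin⟩

lemma IsC2Hypersurface.integrableOn_of_continuousOn (hM : IsC2Hypersurface M)
    {K U : Set (E n)} (hU : Disjoint U (closure M \ M)) (hK : IsCompact K) (hKU : K ⊆ U)
    {f : E n → ℝ} (hf : ContinuousOn f M) (hf0 : ∀ x ∈ M, x ∉ K → f x = 0) :
    IntegrableOn f M μHE[n - 1] := by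
  have hMK := isCompact_inter hU hK hKU
  have h1 : IntegrableOn f (M ∩ K) μHE[n - 1] := by
    obtain ⟨C, hC⟩ := hMK.exists_bound_of_continuousOn (hf.mono inter_subset_left)
    exact IntegrableOn.of_bound (hM.measure_lt_top_of_isCompact hMK inter_subset_left)
      ((hf.mono inter_subset_left).aestronglyMeasurable hMK.measurableSet) C
      ((ae_restrict_iff' hMK.measurableSet).2 (Eventually.of_forall hC))
  exact h1.of_forall_sdiff_eq_zero hM.measurableSet fun x hx =>
    hf0 x hx.1 fun hxK => hx.2 ⟨hx.1, hxK⟩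

/-! ### The tangential Jacobian and its derivative -/

/-- The Weinstein–Aronszajn identity for linear maps. -/
lemma det_one_add_comp_comm {V W : Type*} [AddCommGroup V] [Module ℝ V] [AddCommGroup W]
    [Module ℝ W] [FiniteDimensional ℝ V] [FiniteDimensional ℝ W] (f : V →ₗ[ℝ] W)
    (g : W →ₗ[ℝ] V) :
    LinearMap.det (1 + f ∘ₗ g) = LinearMap.det (1 + g ∘ₗ f) := by
  let bV := Module.finBasis ℝ V
  let bW := Module.finBasis ℝ W
  rw [← LinearMap.det_toMatrix bW, ← LinearMap.det_toMatrix bV, map_add, map_add,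
    LinearMap.toMatrix_comp bW bV bW, LinearMap.toMatrix_comp bV bW bV, LinearMap.toMatrix_one,
    LinearMap.toMatrix_one, Matrix.det_one_add_mul_comm]

/-- For the orthogonal projection `Q` to a subspace `T`, this is the Gram determinant
`det (Lᵀ L)` of the restriction `L` of `A` to `T`, written as the determinant of an endomorphism
of the whole space. -/
def gramDet (A Q : E n →L[ℝ] E n) : ℝ :=
  (1 + (ContinuousLinearMap.adjoint A * A - 1) * Q).det

lemma tangentialJacobian_eq (M : Set (E n)) (ψ : E n → E n) (x : E n) :
    tangentialJacobian M ψ x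
      = √(gramDet (fderiv ℝ ψ x) (tangentSpace M x).starProjection) := by
  unfold tangentialJacobian gramDet
  set T := tangentSpace M x
  set A := fderiv ℝ ψ x
  set C := ContinuousLinearMap.adjoint A * A - 1 with hC
  -- with `ι` the inclusion of `T` and `π` the projection, `(A ι)ᵀ (A ι) = 1 + π C ι`, and `ι π` is
  -- the orthogonal projection as an endomorphism of the whole space
  have h1 : ((ContinuousLinearMap.adjoint (A.comp T.subtypeL)).comp (A.comp T.subtypeL) :
        T →L[ℝ] T)
      = 1 + (T.orthogonalProjectionOnto.comp (C.comp T.subtypeL)) := by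
    ext1 v
    rw [ContinuousLinearMap.adjoint_comp, Submodule.adjoint_subtypeL]
    simp [hC]
  change √(ContinuousLinearMap.det ((ContinuousLinearMap.adjoint (A.comp T.subtypeL)).comp
    (A.comp T.subtypeL))) = _
  rw [h1]
  congr 1
  exact det_one_add_comp_comm (T.orthogonalProjectionOnto : E n →ₗ[ℝ] T)
    ((C.comp T.subtypeL : T →L[ℝ] E n) : T →ₗ[ℝ] E n)

lemma contDiff_det {k : WithTop ℕ∞} :
    ContDiff ℝ k (fun A : E n →L[ℝ] E n => A.det) := by
  let b := EuclideanSpace.basisFun (Fin n) ℝ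
  have h : (fun A : E n →L[ℝ] E n => A.det)
      = fun A => ∑ σ : Equiv.Perm (Fin n), (Equiv.Perm.sign σ : ℝ) * ∏ i, A (b i) (σ i) := by
    ext A
    rw [ContinuousLinearMap.det, ← LinearMap.det_toMatrix b.toBasis, Matrix.det_apply']
    simp [LinearMap.toMatrix_apply, b]
  rw [h]
  refine ContDiff.sum fun σ _ => contDiff_const.mul (contDiff_prod fun i _ => ?_)
  exact (EuclideanSpace.proj (σ i) ∘L ContinuousLinearMap.apply ℝ (E n) (b i)).contDiff

/-- The differential of the determinant at the identity is the trace. -/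
lemma fderiv_det_one (B : E n →L[ℝ] E n) :
    fderiv ℝ (fun A : E n →L[ℝ] E n => A.det) 1 B = LinearMap.trace ℝ (E n) B := by
  let b := EuclideanSpace.basisFun (Fin n) ℝ
  set m := LinearMap.toMatrix b.toBasis b.toBasis (B : E n →ₗ[ℝ] E n) with hm
  have hl : HasDerivAt (fun t : ℝ => (1 : E n →L[ℝ] E n) + t • B) B 0 := by
    simpa using ((hasDerivAt_id (0 : ℝ)).smul_const B).const_add 1
  have h1 : HasDerivAt (fun t : ℝ => ((1 : E n →L[ℝ] E n) + t • B).det)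
      (fderiv ℝ (fun A : E n →L[ℝ] E n => A.det) 1 B) 0 := by
    have h0 : (1 : E n →L[ℝ] E n) + (0 : ℝ) • B = 1 := by
      rw [show (0 : ℝ) • B = 0 from zero_smul ℝ B, add_zero]
    have h2 : HasFDerivAt (fun A : E n →L[ℝ] E n => A.det)
        (fderiv ℝ (fun A : E n →L[ℝ] E n => A.det) 1) (1 + (0 : ℝ) • B) := by
      rw [h0]
      exact ((contDiff_det (k := 1)).differentiable one_ne_zero 1).hasFDerivAt
    exact h2.comp_hasDerivAt (0 : ℝ) hl
  let q := (Matrix.det (1 + (Polynomial.X : Polynomial ℝ) • m.map Polynomial.C)).divX.divX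
  have h3 : (fun t : ℝ => ((1 : E n →L[ℝ] E n) + t • B).det)
      = fun t : ℝ => 1 + m.trace * t + q.eval t * t ^ 2 := by
    ext t
    rw [← Matrix.det_one_add_smul, ContinuousLinearMap.det, ← LinearMap.det_toMatrix b.toBasis]
    simp [hm, LinearMap.toMatrix_one]
  have h4 : HasDerivAt (fun t : ℝ => 1 + m.trace * t + q.eval t * t ^ 2) m.trace 0 := by
    have := (((hasDerivAt_id (0 : ℝ)).const_mul m.trace).const_add 1).add
      ((q.hasDerivAt 0).mul ((hasDerivAt_id (0 : ℝ)).pow 2))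
    refine this.congr_deriv ?_
    simp
  rw [h3] at h1
  rw [h1.unique h4, hm, ← LinearMap.trace_eq_matrix_trace]

lemma gramDet_one (Q : E n →L[ℝ] E n) : gramDet 1 Q = 1 := by
  have : ContinuousLinearMap.adjoint (1 : E n →L[ℝ] E n) = 1 := ContinuousLinearMap.adjoint_id
  simp [gramDet, this, ContinuousLinearMap.det]

lemma contDiff_adjoint_mul_self {k : WithTop ℕ∞} :
    ContDiff ℝ k (fun A : E n →L[ℝ] E n => ContinuousLinearMap.adjoint A * A) := by
  have h : ContDiff ℝ k (fun A : E n →L[ℝ] E n => ContinuousLinearMap.adjoint A) :=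
    (ContinuousLinearMap.adjoint (𝕜 := ℝ) (E := E n) (F := E n)).toContinuousLinearEquiv.contDiff
  exact h.mul contDiff_id

lemma contDiff_gramDet {k : WithTop ℕ∞} :
    ContDiff ℝ k (fun p : (E n →L[ℝ] E n) × (E n →L[ℝ] E n) => gramDet p.1 p.2) := by
  unfold gramDet
  refine contDiff_det.comp (contDiff_const.add (ContDiff.mul ?_ contDiff_snd))
  exact (contDiff_adjoint_mul_self.comp contDiff_fst).sub contDiff_const

/-- The divergence `tr (B ∘ Q)` of a vector field with differential `B` along the subspace `T`
with orthogonal projection `Q`. -/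
def tangentialDiv (B Q : E n →L[ℝ] E n) : ℝ :=
  LinearMap.trace ℝ (E n) ((B * Q : E n →L[ℝ] E n) : E n →ₗ[ℝ] E n)

lemma trace_adjoint_mul (B : E n →L[ℝ] E n) (T : Submodule ℝ (E n)) :
    LinearMap.trace ℝ (E n)
      ((ContinuousLinearMap.adjoint B * T.starProjection : E n →L[ℝ] E n) : E n →ₗ[ℝ] E n)
      = tangentialDiv B T.starProjection := by
  have hc : tangentialDiv B T.starProjection = LinearMap.trace ℝ (E n)
      ((T.starProjection * B : E n →L[ℝ] E n) : E n →ₗ[ℝ] E n) :=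
    LinearMap.trace_mul_comm ℝ (B : E n →ₗ[ℝ] E n) (T.starProjection : E n →ₗ[ℝ] E n)
  rw [hc, LinearMap.trace_eq_sum_inner _ (EuclideanSpace.basisFun (Fin n) ℝ),
    LinearMap.trace_eq_sum_inner _ (EuclideanSpace.basisFun (Fin n) ℝ)]
  refine Finset.sum_congr rfl fun i _ => ?_
  simp only [ContinuousLinearMap.coe_coe, mul_apply_eq_comp]
  rw [ContinuousLinearMap.adjoint_inner_right, ← Submodule.inner_starProjection_left_eq_right,
    real_inner_comm]

/-- First variation of the Jacobian: if `A 0 = 1`, the derivative of the Jacobian of `A t` on `T` at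
`t = 0` is the trace of `A' 0` on `T`. -/
lemma hasDerivAt_sqrt_gramDet {A : ℝ → E n →L[ℝ] E n} {B : E n →L[ℝ] E n} (hA0 : A 0 = 1)
    (hA : HasDerivAt A B 0) (T : Submodule ℝ (E n)) :
    HasDerivAt (fun t => √(gramDet (A t) T.starProjection))
      (tangentialDiv B T.starProjection) 0 := by
  have hone : ContinuousLinearMap.adjoint (1 : E n →L[ℝ] E n) = 1 := ContinuousLinearMap.adjoint_id
  have h1 : HasDerivAt (fun t => ContinuousLinearMap.adjoint (A t))
      (ContinuousLinearMap.adjoint B) 0 :=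
    ((ContinuousLinearMap.adjoint (𝕜 := ℝ) (E := E n)
      (F := E n)).toContinuousLinearEquiv.toContinuousLinearMap.hasFDerivAt).comp_hasDerivAt 0 hA
  have h2 : HasDerivAt (fun t => 1 + (ContinuousLinearMap.adjoint (A t) * A t - 1)
      * T.starProjection) ((ContinuousLinearMap.adjoint B + B) * T.starProjection) 0 := by
    have := (((h1.mul hA).sub_const 1).mul_const T.starProjection).const_add 1
    simpa [hA0, hone] using this
  have h3 : HasDerivAt (fun t => gramDet (A t) T.starProjection)
      (2 * tangentialDiv B T.starProjection) 0 := by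
    have hd : HasFDerivAt (fun A : E n →L[ℝ] E n => A.det)
        (fderiv ℝ (fun A : E n →L[ℝ] E n => A.det) 1)
        (1 + (ContinuousLinearMap.adjoint (A 0) * A 0 - 1) * T.starProjection) := by
      rw [hA0, hone]
      simpa using ((contDiff_det (n := n) (k := 1)).differentiable one_ne_zero 1).hasFDerivAt
    have h4 := hd.comp_hasDerivAt (0 : ℝ) h2
    rw [fderiv_det_one, add_mul, ContinuousLinearMap.toLinearMap_add, map_add, trace_adjoint_mul] at h4
    rw [two_mul]
    exact h4
  have h5 : gramDet (A 0) T.starProjection = 1 := by rw [hA0, gramDet_one]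
  convert h3.sqrt (by rw [h5]; exact one_ne_zero) using 1
  rw [h5]
  simp

lemma tangentialDiv_add (B C Q : E n →L[ℝ] E n) :
    tangentialDiv (B + C) Q = tangentialDiv B Q + tangentialDiv C Q := by
  simp [tangentialDiv, add_mul]

lemma tangentialDiv_smul (c : ℝ) (B Q : E n →L[ℝ] E n) :
    tangentialDiv (c • B) Q = c * tangentialDiv B Q := by
  simp [tangentialDiv]

lemma tangentialDiv_smulRight (ℓ : E n →L[ℝ] ℝ) (y : E n) (Q : E n →L[ℝ] E n) :
    tangentialDiv (ℓ.smulRight y) Q = ℓ (Q y) := by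
  have h : ((ℓ.smulRight y * Q : E n →L[ℝ] E n) : E n →ₗ[ℝ] E n)
      = ((ℓ.comp Q : E n →L[ℝ] ℝ) : E n →ₗ[ℝ] ℝ).smulRight y := by
    ext1 v; rfl
  rw [tangentialDiv, h, LinearMap.trace_smulRight]
  rfl

/-! ### Differentiation under the integral and the first variation formula -/

section DominatedDifferentiation

variable {G : Type*} [NormedAddCommGroup G] [NormedSpace ℝ G] {Ψ : ℝ × G → ℝ}

lemma hasDerivAt_of_contDiffAt_prod {z : G} (h : ContDiffAt ℝ 1 Ψ (0, z)) :
    HasDerivAt (fun t => Ψ (t, z)) (fderiv ℝ Ψ (0, z) (1, 0)) 0 := by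
  have h1 : HasFDerivAt Ψ (fderiv ℝ Ψ (0, z)) (0, z) :=
    (h.differentiableAt one_ne_zero).hasFDerivAt
  have h2 : HasDerivAt (fun t : ℝ => (t, z)) (1, 0) 0 :=
    (hasDerivAt_id (0 : ℝ)).prodMk (hasDerivAt_const _ _)
  exact h1.comp_hasDerivAt (0 : ℝ) h2

/-- A `C¹` function of `(t, z)` is Lipschitz in `t` at `0`, uniformly for `z` in a compact set. -/
lemma exists_eventually_abs_sub_le {C : Set G} (hC : IsCompact C)
    (h : ∀ z ∈ C, ContDiffAt ℝ 1 Ψ (0, z)) :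
    ∃ L : ℝ, ∀ᶠ t in 𝓝 (0 : ℝ), ∀ z ∈ C, |Ψ (t, z) - Ψ (0, z)| ≤ L * |t| := by
  refine hC.induction_on (p := fun s => ∃ L : ℝ, ∀ᶠ t in 𝓝 (0 : ℝ), ∀ z ∈ s,
    |Ψ (t, z) - Ψ (0, z)| ≤ L * |t|) ⟨0, by simp⟩ ?_ ?_ ?_
  · rintro s t hst ⟨L, hL⟩
    exact ⟨L, hL.mono fun u hu z hz => hu z (hst hz)⟩
  · rintro s t ⟨L, hL⟩ ⟨L', hL'⟩
    refine ⟨max L L', (hL.and hL').mono fun u hu z hz => ?_⟩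
    rcases hz with hz | hz
    · exact (hu.1 z hz).trans (by gcongr; exact le_max_left _ _)
    · exact (hu.2 z hz).trans (by gcongr; exact le_max_right _ _)
  · intro z hz
    obtain ⟨L, W, hW, hlip⟩ := (h z hz).exists_lipschitzOnWith
    rw [nhds_prod_eq] at hW
    obtain ⟨I, hI, J, hJ, hIJ⟩ := mem_prod_iff.1 hW
    refine ⟨J, nhdsWithin_le_nhds hJ, L, ?_⟩
    filter_upwards [hI] with t ht z hz
    have := hlip.dist_le_mul (t, z) (hIJ ⟨ht, hz⟩) (0, z) (hIJ ⟨mem_of_mem_nhds hI, hz⟩)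
    simpa [Prod.dist_eq, Real.dist_eq] using this

/-- Differentiation under the integral over a compact set `S` of an integrand that depends on the
point `x` only through a continuous quantity `q x`, and is a `C¹` function of `(t, q x)`. -/
lemma hasDerivAt_setIntegral_of_contDiffAt {μ : Measure (E n)} {S : Set (E n)}
    (hS : IsCompact S) (hμ : μ S < ⊤) {q : E n → G} (hq : ContinuousOn q S)
    (h : ∀ x ∈ S, ContDiffAt ℝ 1 Ψ (0, q x)) :
    HasDerivAt (fun t => ∫ x in S, Ψ (t, q x) ∂μ) (∫ x in S, fderiv ℝ Ψ (0, q x) (1, 0) ∂μ) 0 := by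
  have hC : IsCompact (q '' S) := hS.image_of_continuousOn hq
  have hΨ : ∀ z ∈ q '' S, ContDiffAt ℝ 1 Ψ (0, z) := by
    rintro _ ⟨x, hx, rfl⟩
    exact h x hx
  obtain ⟨L, hL⟩ := exists_eventually_abs_sub_le hC hΨ
  have hev : ∀ᶠ t in 𝓝 (0 : ℝ), ∀ z ∈ q '' S, ContDiffAt ℝ 1 Ψ (t, z) :=
    hC.eventually_forall_of_forall_eventually fun z hz => (hΨ z hz).eventually (by simp)
  have hcont : ∀ t : ℝ, (∀ z ∈ q '' S, ContDiffAt ℝ 1 Ψ (t, z)) →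
      ContinuousOn (fun x => Ψ (t, q x)) S := fun t ht x hx =>
    ContinuousAt.comp_continuousWithinAt (f := fun x => (t, q x))
      (ht _ (mem_image_of_mem q hx)).continuousAt (continuousWithinAt_const.prodMk (hq x hx))
  have hfd : ContinuousOn (fun x => fderiv ℝ Ψ (0, q x) (1, 0)) S := fun x hx =>
    (ContinuousAt.comp_continuousWithinAt (f := fun x => ((0 : ℝ), q x))
      ((h x hx).fderiv_right (m := 0) (by norm_num)).continuousAt
      (continuousWithinAt_const.prodMk (hq x hx))).clm_apply continuousWithinAt_const
  have hSm := hS.measurableSet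
  have : IsFiniteMeasure (μ.restrict S) := ⟨by simpa using hμ⟩
  have hint : IntegrableOn (fun x => Ψ (0, q x)) S μ := by
    obtain ⟨C, hC⟩ := hS.exists_bound_of_continuousOn (hcont 0 hΨ)
    exact IntegrableOn.of_bound hμ ((hcont 0 hΨ).aestronglyMeasurable hSm) C
      ((ae_restrict_iff' hSm).2 (Eventually.of_forall hC))
  have key := hasFDerivAt_integral_of_dominated_loc_of_lip' (𝕜 := ℝ) (μ := μ.restrict S)
    (F := fun t x => Ψ (t, q x)) (x₀ := (0 : ℝ)) (bound := fun _ => L)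
    (F' := fun x => ContinuousLinearMap.toSpanSingleton ℝ (fderiv ℝ Ψ (0, q x) (1, 0)))
    (hL.and hev) (fun t ht => (hcont t ht.2).aestronglyMeasurable hSm) hint
    ((ContinuousLinearMap.toSpanSingletonCLE (𝕜 := ℝ) (E := ℝ)).continuous.comp_aestronglyMeasurable
      (hfd.aestronglyMeasurable hSm))
    ((ae_restrict_iff' hSm).2 (Eventually.of_forall fun x hx t ht => by
      simpa using ht.1 _ (mem_image_of_mem q hx)))
    (integrable_const L)
    ((ae_restrict_iff' hSm).2 (Eventually.of_forall fun x hx =>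
      (hasDerivAt_of_contDiffAt_prod (h x hx)).hasFDerivAt))
  have h2 := key.2.hasDerivAt
  rw [ContinuousLinearMap.integral_apply key.1] at h2
  simpa using h2

end DominatedDifferentiation

namespace IsDeformation

variable {K : Set (E n)} {ε : ℝ} {φ : ℝ → E n → E n}

lemma contDiffAt (hφ : IsDeformation K ε φ) {t : ℝ} (ht : t ∈ Ioo (-ε) ε) (x : E n) :
    ContDiffAt ℝ 2 (fun p : ℝ × E n => φ p.1 p.2) (t, x) :=
  hφ.contDiffOn.contDiffAt ((isOpen_Ioo.prod isOpen_univ).mem_nhds ⟨ht, mem_univ x⟩)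

lemma fderiv_eq (hφ : IsDeformation K ε φ) {t : ℝ} (ht : t ∈ Ioo (-ε) ε) (x : E n) :
    fderiv ℝ (φ t) x = (fderiv ℝ (fun p : ℝ × E n => φ p.1 p.2) (t, x)).comp
      (ContinuousLinearMap.inr ℝ ℝ (E n)) := by
  have h1 := ((hφ.contDiffAt ht x).differentiableAt two_ne_zero).hasFDerivAt
  have h2 : HasFDerivAt (fun y : E n => (t, y)) (ContinuousLinearMap.inr ℝ ℝ (E n)) x :=
    hasFDerivAt_prodMk_right t x
  exact (h1.comp x h2).fderiv

lemma contDiffAt_fderiv (hφ : IsDeformation K ε φ) {t : ℝ} (ht : t ∈ Ioo (-ε) ε) (x : E n) :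
    ContDiffAt ℝ 1 (fun p : ℝ × E n => fderiv ℝ (φ p.1) p.2) (t, x) := by
  have h1 : ContDiffAt ℝ 1 (fun p => (fderiv ℝ (fun p : ℝ × E n => φ p.1 p.2) p).comp
      (ContinuousLinearMap.inr ℝ ℝ (E n))) (t, x) :=
    ((hφ.contDiffAt ht x).fderiv_right (m := 1) (by norm_num)).clm_comp contDiffAt_const
  refine h1.congr_of_eventuallyEq ?_
  filter_upwards [(isOpen_Ioo.prod isOpen_univ).mem_nhds
    (show (t, x) ∈ Ioo (-ε) ε ×ˢ (univ : Set (E n)) from ⟨ht, mem_univ x⟩)] with p hp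
  exact hφ.fderiv_eq hp.1 p.2

lemma fderiv_zero (hφ : IsDeformation K ε φ) (x : E n) : fderiv ℝ (φ 0) x = 1 := by
  have : φ 0 = id := funext hφ.zero
  rw [this, fderiv_id]
  rfl

lemma differentiableAt_time (hφ : IsDeformation K ε φ) {t : ℝ} (ht : t ∈ Ioo (-ε) ε) (x : E n) :
    DifferentiableAt ℝ (fun s => φ s x) t :=
  ((hφ.contDiffAt ht x).differentiableAt two_ne_zero).comp t
    (f := fun s : ℝ => (s, x)) (by fun_prop)

lemma differentiableAt_fderiv_time (hφ : IsDeformation K ε φ) {t : ℝ} (ht : t ∈ Ioo (-ε) ε)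
    (x : E n) : DifferentiableAt ℝ (fun s => fderiv ℝ (φ s) x) t :=
  ((hφ.contDiffAt_fderiv ht x).differentiableAt one_ne_zero).comp t
    (f := fun s : ℝ => (s, x)) (by fun_prop)

/-- The first variation formula: the derivative of the weighted area along a deformation with
initial velocity `Y` is the integral of `⟨∇f, Y⟩ + f div_M Y`. -/
lemma hasDerivAt_weightedArea (hφ : IsDeformation K ε φ) (hε : 0 < ε)
    (hM : IsC2Hypersurface M) (hMK : IsCompact (M ∩ K)) {f : E n → ℝ}
    (hf : ∀ x ∈ M ∩ K, ContDiffAt ℝ 1 f x) :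
    HasDerivAt (fun t => weightedArea f M (M ∩ K) (φ t))
      (∫ x in M ∩ K, (fderiv ℝ f x (deriv (fun t => φ t x) 0)
        + f x * tangentialDiv (deriv (fun t => fderiv ℝ (φ t) x) 0)
          (tangentSpace M x).starProjection) ∂μHE[n - 1]) 0 := by
  have h0 : (0 : ℝ) ∈ Ioo (-ε) ε := ⟨neg_lt_zero.2 hε, hε⟩
  let Ψ : ℝ × (E n × (E n →L[ℝ] E n)) → ℝ := fun p =>
    f (φ p.1 p.2.1) * √(gramDet (fderiv ℝ (φ p.1) p.2.1) p.2.2)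
  let q : E n → E n × (E n →L[ℝ] E n) := fun x => (x, (tangentSpace M x).starProjection)
  have hq : ContinuousOn q (M ∩ K) :=
    continuousOn_id.prodMk (hM.continuousOn_starProjection.mono inter_subset_left)
  have hΨ : ∀ x ∈ M ∩ K, ContDiffAt ℝ 1 Ψ (0, q x) := by
    intro x hx
    have hpr : ContDiffAt ℝ 1 (fun p : ℝ × (E n × (E n →L[ℝ] E n)) => (p.1, p.2.1)) (0, q x) := by
      fun_prop
    have h1 : ContDiffAt ℝ 1 (fun p : ℝ × (E n × (E n →L[ℝ] E n)) => φ p.1 p.2.1) (0, q x) :=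
      ContDiffAt.comp (0, q x) (g := fun p : ℝ × E n => φ p.1 p.2)
        ((hφ.contDiffAt h0 x).of_le (by norm_num)) hpr
    have h2 : ContDiffAt ℝ 1 (fun p : ℝ × (E n × (E n →L[ℝ] E n)) => f (φ p.1 p.2.1)) (0, q x) := by
      have : ContDiffAt ℝ 1 f (φ 0 x) := by rw [hφ.zero]; exact hf x hx
      exact ContDiffAt.comp (0, q x) this h1
    have h3 : ContDiffAt ℝ 1 (fun p : ℝ × (E n × (E n →L[ℝ] E n)) =>
        fderiv ℝ (φ p.1) p.2.1) (0, q x) :=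
      ContDiffAt.comp (0, q x) (g := fun p : ℝ × E n => fderiv ℝ (φ p.1) p.2)
        (hφ.contDiffAt_fderiv h0 x) hpr
    have h4 : ContDiffAt ℝ 1 (fun p : ℝ × (E n × (E n →L[ℝ] E n)) =>
        gramDet (fderiv ℝ (φ p.1) p.2.1) p.2.2) (0, q x) :=
      contDiff_gramDet.contDiffAt.comp (0, q x)
        (f := fun p : ℝ × (E n × (E n →L[ℝ] E n)) => (fderiv ℝ (φ p.1) p.2.1, p.2.2))
        (h3.prodMk (by fun_prop))
    refine h2.mul (h4.sqrt ?_)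
    change gramDet (fderiv ℝ (φ 0) x) _ ≠ 0
    rw [hφ.fderiv_zero, gramDet_one]
    exact one_ne_zero
  have key := hasDerivAt_setIntegral_of_contDiffAt hMK
    (hM.measure_lt_top_of_isCompact hMK inter_subset_left) hq hΨ
  have e1 : (fun t => weightedArea f M (M ∩ K) (φ t))
      = fun t => ∫ x in M ∩ K, Ψ (t, q x) ∂μHE[n - 1] := by
    ext t
    simp only [weightedArea, tangentialJacobian_eq, Ψ, q]
  rw [e1]
  refine key.congr_deriv (setIntegral_congr_fun hMK.measurableSet fun x hx => ?_)
  refine (hasDerivAt_of_contDiffAt_prod (hΨ x hx)).unique ?_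
  have hY := (hφ.differentiableAt_time h0 x).hasDerivAt
  have hB := (hφ.differentiableAt_fderiv_time h0 x).hasDerivAt
  have hfx : HasFDerivAt f (fderiv ℝ f x) (φ 0 x) := by
    rw [hφ.zero]; exact ((hf x hx).differentiableAt one_ne_zero).hasFDerivAt
  have := (hfx.comp_hasDerivAt (0 : ℝ) hY).mul
    (hasDerivAt_sqrt_gramDet (hφ.fderiv_zero x) hB (tangentSpace M x))
  refine this.congr_deriv ?_
  simp [hφ.zero, hφ.fderiv_zero, gramDet_one]

end IsDeformation

/-! ### Stationarity for weights with tangential gradient -/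

lemma exists_contDiff_bounded_extension {K U : Set (E n)} (hK : IsCompact K) (hU : IsOpen U)
    (hKU : K ⊆ U) {f : E n → ℝ} (hf : ContDiffOn ℝ 2 f U) :
    ∃ g : E n → ℝ, ContDiff ℝ 2 g ∧ (∃ C, ∀ x, |g x| ≤ C) ∧ ∀ x ∈ K, g =ᶠ[𝓝 x] f := by
  obtain ⟨L, hL, hKL, hLU⟩ := exists_compact_between hK hU hKU
  obtain ⟨χ, h1, h0, -⟩ := exists_contMDiffMap_one_nhds_of_subset_interior (n := 2)
    (modelWithCornersSelf ℝ (E n)) hK.isClosed hKL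
  have hχ : ContDiff ℝ 2 χ := χ.contMDiff.contDiff
  have hg : ContDiff ℝ 2 fun x => χ x * f x := by
    refine contDiff_iff_contDiffAt.2 fun x => ?_
    by_cases hx : x ∈ U
    · exact hχ.contDiffAt.mul (hf.contDiffAt (hU.mem_nhds hx))
    · have h2 : (fun x => χ x * f x) =ᶠ[𝓝 x] fun _ => 0 := by
        filter_upwards [hL.isClosed.isOpen_compl.mem_nhds fun h => hx (hLU h)] with y hy
        rw [h0 y hy, zero_mul]
      exact contDiffAt_const.congr_of_eventuallyEq h2
  obtain ⟨C, hC⟩ := hL.exists_bound_of_continuousOn hg.continuous.continuousOn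
  refine ⟨fun x => χ x * f x, hg, ⟨max C 0, fun x => ?_⟩, fun x hx => ?_⟩
  · by_cases hx : x ∈ L
    · exact (hC x hx).trans (le_max_left _ _)
    · simp [h0 x hx]
  · filter_upwards [eventually_nhdsSet_iff_forall.1 h1 x hx] with y hy
    rw [hy, one_mul]

namespace IsDeformation

variable {K : Set (E n)} {ε : ℝ} {φ : ℝ → E n → E n} {g : E n → ℝ} {C : ℝ}

/-- Running a deformation at the position-dependent speed `g x` multiplies its initial velocity
by `g` and needs no more smoothness than that of `g`. -/
lemma rescale (hφ : IsDeformation K ε φ) (hg : ContDiff ℝ 2 g) (hC : ∀ x, |g x| ≤ C)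
    (hC0 : 0 < C) :
    IsDeformation K (ε / C) fun t x => φ (t * g x) x := by
  have hmem : ∀ t ∈ Ioo (-(ε / C)) (ε / C), ∀ x, t * g x ∈ Ioo (-ε) ε := by
    intro t ht x
    rw [mem_Ioo, ← abs_lt, abs_mul]
    have h1 : |t| * C < ε := (lt_div_iff₀ hC0).1 (abs_lt.2 ht)
    exact (mul_le_mul_of_nonneg_left (hC x) (abs_nonneg t)).trans_lt h1
  refine ⟨?_, fun x => by simp [hφ.zero], fun t ht x hx => hφ.fixed _ (hmem t ht x) x hx⟩
  have h1 : ContDiff ℝ 2 fun p : ℝ × E n => (p.1 * g p.2, p.2) :=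
    (contDiff_fst.mul (hg.comp contDiff_snd)).prodMk contDiff_snd
  exact hφ.contDiffOn.comp h1.contDiffOn fun p hp => ⟨hmem p.1 hp.1 p.2, mem_univ _⟩

/-- The velocity of the differential of the rescaled deformation is the differential of `g Y`, in
the form `dg ⊗ Y + g DY` that needs no second derivative of `φ` in space. -/
lemma deriv_fderiv_rescale (hφ : IsDeformation K ε φ) (hε : 0 < ε) (hg : ContDiff ℝ 2 g)
    (x : E n) :
    deriv (fun t => fderiv ℝ (fun y => φ (t * g y) y) x) 0
      = (fderiv ℝ g x).smulRight (deriv (fun t => φ t x) 0)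
        + g x • deriv (fun t => fderiv ℝ (φ t) x) 0 := by
  have h0 : (0 : ℝ) ∈ Ioo (-ε) ε := ⟨neg_lt_zero.2 hε, hε⟩
  have hlin : HasDerivAt (fun t : ℝ => t * g x) (g x) 0 := by
    simpa using (hasDerivAt_id (0 : ℝ)).mul_const (g x)
  have hsmall : ∀ᶠ t in 𝓝 (0 : ℝ), t * g x ∈ Ioo (-ε) ε := by
    apply hlin.continuousAt.eventually_mem
    simpa using Ioo_mem_nhds h0.1 h0.2
  set Φ : ℝ × E n → E n := fun p => φ p.1 p.2 with hΦ
  have hev : (fun t => fderiv ℝ (fun y => φ (t * g y) y) x) =ᶠ[𝓝 0] fun t =>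
      t • (fderiv ℝ g x).smulRight (fderiv ℝ Φ (t * g x, x) (1, 0))
        + fderiv ℝ (φ (t * g x)) x := by
    filter_upwards [hsmall] with t ht
    have h1 : HasFDerivAt Φ (fderiv ℝ Φ (t * g x, x)) (t * g x, x) :=
      ((hφ.contDiffAt ht x).differentiableAt two_ne_zero).hasFDerivAt
    have h2 : HasFDerivAt (fun y => (t * g y, y))
        ((t • fderiv ℝ g x).prod (ContinuousLinearMap.id ℝ (E n))) x :=
      ((hg.differentiable two_ne_zero x).hasFDerivAt.const_mul t).prodMk (hasFDerivAt_id x)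
    refine (HasFDerivAt.comp x (f := fun y => (t * g y, y)) h1 h2).fderiv.trans ?_
    ext1 v
    rw [hφ.fderiv_eq ht x]
    have h3 : (t * fderiv ℝ g x v, v) = (t * fderiv ℝ g x v) • ((1 : ℝ), (0 : E n)) + (0, v) := by
      simp
    simp only [ContinuousLinearMap.comp_apply, ContinuousLinearMap.prod_apply,
      smul_apply, smul_eq_mul, ContinuousLinearMap.id_apply,
      add_apply, ContinuousLinearMap.smulRight_apply,
      ContinuousLinearMap.inr_apply]
    rw [h3, map_add, map_smul, smul_smul]
  have hd1 : DifferentiableAt ℝ (fun t : ℝ =>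
      (fderiv ℝ g x).smulRight (fderiv ℝ Φ (t * g x, x) (1, 0))) 0 := by
    have h1 : DifferentiableAt ℝ (fderiv ℝ Φ) (0 * g x, x) := by
      rw [zero_mul]
      exact ((hφ.contDiffAt h0 x).fderiv_right (m := 1) (by norm_num)).differentiableAt one_ne_zero
    have h2 : DifferentiableAt ℝ (fun t : ℝ => fderiv ℝ Φ (t * g x, x)) 0 :=
      DifferentiableAt.comp (0 : ℝ) (f := fun t : ℝ => (t * g x, x)) h1 (by fun_prop)
    exact ((ContinuousLinearMap.smulRightL ℝ (E n) (E n) (fderiv ℝ g x)).differentiableAt).comp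
      (0 : ℝ) (h2.clm_apply (differentiableAt_const _))
  have hd2 : HasDerivAt (fun t => fderiv ℝ (φ (t * g x)) x)
      (g x • deriv (fun t => fderiv ℝ (φ t) x) 0) 0 := by
    have h2 : HasDerivAt (fun t => fderiv ℝ (φ t) x) (deriv (fun t => fderiv ℝ (φ t) x) 0)
        (0 * g x) := by
      rw [zero_mul]
      exact (hφ.differentiableAt_fderiv_time h0 x).hasDerivAt
    exact h2.scomp (0 : ℝ) hlin
  have hY : fderiv ℝ Φ (0, x) (1, 0) = deriv (fun t => φ t x) 0 := by
    have h1 : HasFDerivAt Φ (fderiv ℝ Φ (0, x)) (0, x) :=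
      ((hφ.contDiffAt h0 x).differentiableAt two_ne_zero).hasFDerivAt
    have h2 : HasDerivAt (fun t : ℝ => (t, x)) (1, 0) 0 :=
      (hasDerivAt_id (0 : ℝ)).prodMk (hasDerivAt_const _ _)
    exact (h1.comp_hasDerivAt (0 : ℝ) h2).deriv.symm
  rw [hev.deriv_eq]
  refine ((((hasDerivAt_id (0 : ℝ)).smul hd1.hasDerivAt).add hd2).congr_deriv ?_).deriv
  rw [← hY]
  simp

end IsDeformation

/-- If the gradient of the weight `f` is tangent to the area-stationary hypersurface `M`,
then `M` is `f`-stationary: the first variation of the `f`-weighted area with velocity `Y` is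
the first variation of the area with velocity `f Y`. -/
lemma IsFStationary.of_area {U : Set (E n)} (hM : IsC2Hypersurface M) (hU : IsOpen U)
    (hUM : Disjoint U (closure M \ M)) (hst : IsFStationary (fun _ => (1 : ℝ)) M U)
    {f : E n → ℝ} (hf : ContDiffOn ℝ 2 f U)
    (htan : ∀ x ∈ M ∩ U, ∀ v ∈ (tangentSpace M x)ᗮ, fderiv ℝ f x v = 0) :
    IsFStationary f M U := by
  intro K ε φ hK hKU hε hφ
  have hMK := isCompact_inter hUM hK hKU
  obtain ⟨g, hg, ⟨C, hC⟩, hgf⟩ := exists_contDiff_bounded_extension hK hU hKU hf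
  have hC1 : 0 < max C 1 := lt_max_of_lt_right one_pos
  have hψ := hφ.rescale hg (fun x => (hC x).trans (le_max_left C 1)) hC1
  have hε' : 0 < ε / max C 1 := div_pos hε hC1
  have h1 := hst K _ _ hK hKU hε' hψ
  have h2 := (hψ.hasDerivAt_weightedArea hε' hM hMK (f := fun _ => (1 : ℝ))
    fun _ _ => contDiffAt_const).unique h1
  refine (hφ.hasDerivAt_weightedArea hε hM hMK fun x hx =>
    (hf.contDiffAt (hU.mem_nhds (hKU hx.2))).of_le (by norm_num)).congr_deriv
      (Eq.trans (setIntegral_congr_fun hMK.measurableSet fun x hx => ?_) h2)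
  set Y := deriv (fun t => φ t x) 0
  have hY : fderiv ℝ f x ((tangentSpace M x).starProjection Y) = fderiv ℝ f x Y := by
    have h3 := htan x ⟨hx.1, hKU hx.2⟩ _
      ((tangentSpace M x).sub_starProjection_mem_orthogonal Y)
    rw [map_sub, sub_eq_zero] at h3
    exact h3.symm
  simp only [hφ.deriv_fderiv_rescale hε hg x, tangentialDiv_add, tangentialDiv_smul,
    tangentialDiv_smulRight, (hgf x hx.2).fderiv_eq, (hgf x hx.2).eq_of_nhds]
  simp [Y, hY]

/-! ### Conical hypersurfaces and normal variation fields -/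

/-- The scaling law of the Hausdorff measure on a conical set. -/
lemma setIntegral_comp_smul (hcone : ∀ x ∈ M, ∀ t : ℝ, 0 < t → t • x ∈ M) (φ : E n → ℝ) {t : ℝ}
    (ht : 0 < t) :
    t ^ (n - 1) * ∫ x in M, φ (t • x) ∂μHE[n - 1] = ∫ x in M, φ x ∂μHE[n - 1] := by
  have he : MeasurableEmbedding (fun x : E n => t • x) :=
    (Homeomorph.smulOfNeZero t ht.ne').measurableEmbedding
  have hpre : (fun x : E n => t • x) ⁻¹' M = M := by
    ext x
    refine ⟨fun hx => ?_, fun hx => hcone x hx t ht⟩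
    have := hcone _ hx t⁻¹ (inv_pos.2 ht)
    rwa [inv_smul_smul₀ ht.ne'] at this
  have hmap : (μHE[n - 1] : Measure (E n)).map (fun x => t • x)
      = ENNReal.ofReal ((t ^ (n - 1))⁻¹) • μHE[n - 1] := by
    ext s hs
    rw [he.map_apply, Set.preimage_smul₀ ht.ne',
      Measure.euclideanHausdorffMeasure_smul₀ _ (inv_ne_zero ht.ne'), Measure.smul_apply,
      ENNReal.smul_def, smul_eq_mul, smul_eq_mul]
    congr 1
    rw [ENNReal.ofReal, ENNReal.coe_inj, ← NNReal.coe_inj]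
    simp [Real.coe_toNNReal _ (inv_nonneg.2 (pow_nonneg ht.le (n - 1))), abs_of_pos ht]
  have h1 := he.setIntegral_map (μ := μHE[n - 1]) φ M
  rw [hpre, hmap, Measure.restrict_smul, integral_smul_measure,
    ENNReal.toReal_ofReal (inv_nonneg.2 (pow_nonneg ht.le _)), smul_eq_mul] at h1
  rw [← h1, mul_inv_cancel_left₀ (pow_ne_zero _ ht.ne')]

/-- The divergence theorem for the radial vector field on a conical hypersurface, obtained by
differentiating the scaling law of the Hausdorff measure. -/
lemma integral_radial_deriv (hM : IsC2Hypersurface M)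
    (hcone : ∀ x ∈ M, ∀ t : ℝ, 0 < t → t • x ∈ M) {U : Set (E n)} (hU : IsOpen U)
    (hUM : Disjoint U (closure M \ M)) {φ : E n → ℝ} (hφ : ContDiff ℝ 1 φ)
    (hc : HasCompactSupport φ) (hφU : tsupport φ ⊆ U) :
    IntegrableOn (fun x => fderiv ℝ φ x x + (n - 1 : ℕ) * φ x) M μHE[n - 1] ∧
      ∫ x in M, (fderiv ℝ φ x x + (n - 1 : ℕ) * φ x) ∂μHE[n - 1] = 0 := by
  obtain ⟨K, hK, hφK, hKU⟩ := exists_compact_between hc hU hφU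
  have hMK := isCompact_inter hUM hK hKU
  have hsub : M ∩ K ⊆ M := inter_subset_left
  -- `K` is a neighbourhood of the support of `φ`, hence contains the supports of the rescalings of
  -- `φ` by factors near `1`, and all integrals can be taken over the compact set `M ∩ K`
  have hzero : ∀ᶠ t in 𝓝 (0 : ℝ), ∀ x ∉ K, φ ((1 + t) • x) = 0 := by
    have h1 : ∀ᶠ t in 𝓝 (0 : ℝ), ∀ y ∈ tsupport φ, (1 + t)⁻¹ • y ∈ interior K := by
      refine IsCompact.eventually_forall_of_forall_eventually hc fun y hy => ?_
      have h2 : ContinuousAt (fun p : ℝ × E n => (1 + p.1)⁻¹ • p.2) (0, y) := by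
        have h3 : ContinuousAt (fun p : ℝ × E n => 1 + p.1) (0, y) := by fun_prop
        exact (h3.inv₀ (by simp)).smul continuousAt_snd
      apply h2.eventually_mem
      simpa using isOpen_interior.mem_nhds (hφK hy)
    have h3 : ∀ᶠ t in 𝓝 (0 : ℝ), -1 < t := lt_mem_nhds (by norm_num)
    filter_upwards [h1, h3] with t ht ht1 x hx
    by_contra hne
    have h4 := ht _ (subset_tsupport φ hne)
    rw [inv_smul_smul₀ (by linarith)] at h4
    exact hx (interior_subset h4)
  have hφ0 : ∀ x ∉ K, φ x = 0 := fun x hx => by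
    simpa using hzero.self_of_nhds x hx
  have hdφ0 : ∀ x ∉ K, fderiv ℝ φ x = 0 := fun x hx =>
    Function.notMem_support.1 fun h => hx (interior_subset (hφK (support_fderiv_subset ℝ h)))
  have hcont1 : Continuous fun x => fderiv ℝ φ x x :=
    (hφ.continuous_fderiv one_ne_zero).clm_apply continuous_id
  have hint1 : IntegrableOn (fun x => fderiv ℝ φ x x) M μHE[n - 1] :=
    hM.integrableOn_of_continuousOn hUM hK hKU hcont1.continuousOn
      fun x _ hx => by simp [hdφ0 x hx]
  have hint2 : IntegrableOn φ M μHE[n - 1] :=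
    hM.integrableOn_of_continuousOn hUM hK hKU hφ.continuous.continuousOn fun x _ hx => hφ0 x hx
  refine ⟨hint1.add (hint2.const_mul _), ?_⟩
  rw [integral_add hint1 (hint2.const_mul _), integral_const_mul]
  let Ψ : ℝ × E n → ℝ := fun p => φ ((1 + p.1) • p.2)
  have hΨ : ContDiff ℝ 1 Ψ := hφ.comp (by fun_prop)
  have hD := hasDerivAt_setIntegral_of_contDiffAt (Ψ := Ψ) (q := fun x => x) hMK
    (hM.measure_lt_top_of_isCompact hMK hsub) continuousOn_id fun x _ => hΨ.contDiffAt
  have hval : ∫ x in M ∩ K, fderiv ℝ Ψ (0, x) (1, 0) ∂μHE[n - 1]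
      = ∫ x in M, fderiv ℝ φ x x ∂μHE[n - 1] := by
    rw [setIntegral_eq_of_subset_of_forall_sdiff_eq_zero hM.measurableSet hsub]
    · refine setIntegral_congr_fun hMK.measurableSet fun x _ => ?_
      refine (hasDerivAt_of_contDiffAt_prod hΨ.contDiffAt).unique ?_
      have h1 : HasDerivAt (fun t : ℝ => (1 + t) • x) x 0 := by
        simpa using ((hasDerivAt_id (0 : ℝ)).const_add 1).smul_const x
      have h2 : HasFDerivAt φ (fderiv ℝ φ x) ((1 + (0 : ℝ)) • x) := by
        rw [add_zero, one_smul]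
        exact (hφ.differentiable one_ne_zero x).hasFDerivAt
      exact h2.comp_hasDerivAt (0 : ℝ) h1
    · intro x hx
      simp [hdφ0 x fun h => hx.2 ⟨hx.1, h⟩]
  rw [hval] at hD
  have hpow : HasDerivAt (fun t : ℝ => (1 + t) ^ (n - 1)) ((n - 1 : ℕ) : ℝ) 0 := by
    refine (((hasDerivAt_id (0 : ℝ)).const_add 1).pow (n - 1)).congr_deriv ?_
    simp
  have hprod := hpow.mul hD
  have hconst : (fun t : ℝ => (1 + t) ^ (n - 1) * ∫ x in M ∩ K, Ψ (t, x) ∂μHE[n - 1])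
      =ᶠ[𝓝 0] fun _ => ∫ x in M, φ x ∂μHE[n - 1] := by
    have h3 : ∀ᶠ t in 𝓝 (0 : ℝ), -1 < t := lt_mem_nhds (by norm_num)
    filter_upwards [hzero, h3] with t ht ht1
    rw [← setIntegral_comp_smul hcone φ (t := 1 + t) (by linarith),
      setIntegral_eq_of_subset_of_forall_sdiff_eq_zero hM.measurableSet hsub]
    exact fun x hx => ht x fun h => hx.2 ⟨hx.1, h⟩
  have hfin := hprod.unique ((hasDerivAt_const (0 : ℝ) _).congr_of_eventuallyEq hconst)
  have h0 : ∫ x in M ∩ K, Ψ (0, x) ∂μHE[n - 1] = ∫ x in M, φ x ∂μHE[n - 1] := by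
    simpa using hconst.self_of_nhds
  rw [h0] at hfin
  simp only [add_zero, one_pow, one_mul] at hfin
  linarith

/-- The position vector is tangent to a conical hypersurface. -/
lemma mem_tangentSpace_self (hcone : ∀ x ∈ M, ∀ t : ℝ, 0 < t → t • x ∈ M) {x : E n}
    (hx : x ∈ M) : x ∈ tangentSpace M x := by
  have h1 : HasDerivAt (fun t : ℝ => (1 + t) • x) x 0 := by
    simpa using ((hasDerivAt_id (0 : ℝ)).const_add 1).smul_const x
  have h2 := mem_tangentSpace_of_hasDerivAt (M := M) h1 ?_
  · simpa using h2
  · filter_upwards [lt_mem_nhds (show (-1 : ℝ) < 0 by norm_num)] with t ht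
    exact hcone x hx _ (by linarith)

lemma sum_inner_tangentFrame {x v : E n} (hv : v ∈ tangentSpace M x) :
    ∑ i, ⟪tangentFrame M x i, v⟫ • tangentFrame M x i = v := by
  have h := congrArg (Subtype.val)
    ((stdOrthonormalBasis ℝ (tangentSpace M x)).sum_repr' ⟨v, hv⟩)
  simpa [tangentFrame] using h

lemma sum_inner_sq_tangentFrame (x v : E n) :
    ∑ i, ⟪tangentFrame M x i, v⟫ ^ 2 = ‖(tangentSpace M x).starProjection v‖ ^ 2 := by
  have h := (stdOrthonormalBasis ℝ (tangentSpace M x)).sum_sq_norm_inner_right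
    ((tangentSpace M x).orthogonalProjectionOnto v)
  have h2 : ‖(tangentSpace M x).starProjection v‖
      = ‖(tangentSpace M x).orthogonalProjectionOnto v‖ := rfl
  rw [h2, ← h]
  refine Finset.sum_congr rfl fun i _ => ?_
  rw [Real.norm_eq_abs, sq_abs, Submodule.coe_inner, Submodule.coe_orthogonalProjectionOnto_apply,
    ← Submodule.inner_starProjection_left_eq_right,
    Submodule.starProjection_eq_self_iff.2 (Subtype.coe_prop _)]
  rfl

/-- The Hilbert–Schmidt norm of the restriction of `C` to the tangent space, computed in the
standard basis of the ambient space. -/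
lemma sum_norm_sq_tangentFrame (x : E n) (C : E n →L[ℝ] E n) :
    ∑ i, ‖C (tangentFrame M x i)‖ ^ 2
      = ∑ k, ‖C ((tangentSpace M x).starProjection (EuclideanSpace.basisFun (Fin n) ℝ k))‖ ^ 2 := by
  let b := EuclideanSpace.basisFun (Fin n) ℝ
  set P := (tangentSpace M x).starProjection with hP
  have h1 : ∀ y, ‖y‖ ^ 2 = ∑ j, ⟪b j, y⟫ ^ 2 := fun y => by
    rw [← b.sum_sq_norm_inner_right y]
    simp
  have h2 : ∀ y z, ⟪y, C z⟫ = ⟪z, ContinuousLinearMap.adjoint C y⟫ := fun y z => by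
    rw [ContinuousLinearMap.adjoint_inner_right, real_inner_comm]
  calc ∑ i, ‖C (tangentFrame M x i)‖ ^ 2
      = ∑ j, ∑ i, ⟪tangentFrame M x i, ContinuousLinearMap.adjoint C (b j)⟫ ^ 2 := by
        simp_rw [h1, h2]
        rw [Finset.sum_comm]
    _ = ∑ j, ∑ k, ⟪b k, P (ContinuousLinearMap.adjoint C (b j))⟫ ^ 2 := by
        simp_rw [sum_inner_sq_tangentFrame, ← h1, ← hP]
    _ = ∑ k, ‖C (P (b k))‖ ^ 2 := by
        rw [Finset.sum_comm]
        refine Finset.sum_congr rfl fun k _ => ?_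
        rw [h1]
        simp_rw [h2, hP, Submodule.inner_starProjection_left_eq_right]

lemma normalPart_eq_sub (x w : E n) :
    normalPart M x w = w - (tangentSpace M x).starProjection w := by
  rw [normalPart, Submodule.starProjection_orthogonal_val]

/-- The squared norm `∑ᵢ |(D_{eᵢ} X)^⊥|²` of the normal derivative of `X` along `M` at `x`. -/
def normalGradSq (M : Set (E n)) (X : E n → E n) (x : E n) : ℝ :=
  ∑ i, ‖normalPart M x (fderiv ℝ X x (tangentFrame M x i))‖ ^ 2

lemma IsC2Hypersurface.continuousOn_normalGradSq (hM : IsC2Hypersurface M) {X : E n → E n}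
    (hX : ContDiff ℝ 1 X) :
    ContinuousOn (normalGradSq M X) M := by
  have h1 : normalGradSq M X = fun x =>
        ∑ k, ‖fderiv ℝ X x
            ((tangentSpace M x).starProjection (EuclideanSpace.basisFun (Fin n) ℝ k))
          - (tangentSpace M x).starProjection (fderiv ℝ X x
            ((tangentSpace M x).starProjection (EuclideanSpace.basisFun (Fin n) ℝ k)))‖ ^ 2 := by
    ext x
    have h2 := sum_norm_sq_tangentFrame (M := M) x
      (((tangentSpace M x)ᗮ).starProjection.comp (fderiv ℝ X x))
    simpa only [ContinuousLinearMap.comp_apply, Submodule.starProjection_orthogonal_val,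
      normalPart_eq_sub, normalGradSq] using h2
  rw [h1]
  have hP := hM.continuousOn_starProjection
  have hD := (hX.continuous_fderiv one_ne_zero).continuousOn (s := M)
  refine continuousOn_finsetSum _ fun k _ => ContinuousOn.pow (ContinuousOn.norm ?_) 2
  have h3 := hD.clm_apply (hP.clm_apply (continuousOn_const
    (c := EuclideanSpace.basisFun (Fin n) ℝ k)))
  exact h3.sub (hP.clm_apply h3)

lemma normalGradSq_eq_zero {X : E n → E n} {x : E n} (hx : x ∉ tsupport X) :
    normalGradSq M X x = 0 := by
  have h1 : fderiv ℝ X x = 0 := Function.notMem_support.1 fun hs => hx (support_fderiv_subset ℝ hs)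
  simp [normalGradSq, h1, normalPart]

/-- The effect of a change of the variation field `X` to `g X` on the gradient term of the
second variation, when `∇g = c x` is radial and `M` is conical. -/
lemma normalGradSq_smul {x : E n} (hx : x ∈ tangentSpace M x) {g : E n → ℝ}
    {X : E n → E n} {c : ℝ} (hg : HasFDerivAt g (c • innerSL ℝ x) x)
    (hX : DifferentiableAt ℝ X x) (hXn : X x ∈ (tangentSpace M x)ᗮ) :
    normalGradSq M (fun y => g y • X y) x = g x ^ 2 * normalGradSq M X x
        + 2 * g x * c * ⟪fderiv ℝ X x x, X x⟫ + c ^ 2 * ‖x‖ ^ 2 * ‖X x‖ ^ 2 := by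
  have hN : normalPart M x (X x) = X x := Submodule.starProjection_eq_self_iff.2 hXn
  have hterm : ∀ e, ‖normalPart M x (fderiv ℝ (fun y => g y • X y) x e)‖ ^ 2
      = g x ^ 2 * ‖normalPart M x (fderiv ℝ X x e)‖ ^ 2
        + 2 * g x * c * (⟪e, x⟫ * ⟪fderiv ℝ X x e, X x⟫) + c ^ 2 * ‖X x‖ ^ 2 * ⟪e, x⟫ ^ 2 := by
    intro e
    have h1 : fderiv ℝ (fun y => g y • X y) x e
        = g x • fderiv ℝ X x e + (c * ⟪e, x⟫) • X x := by
      rw [show fderiv ℝ (fun y => g y • X y) x = _ from (hg.smul hX.hasFDerivAt).fderiv]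
      simp [real_inner_comm]
    have h2 : normalPart M x (fderiv ℝ (fun y => g y • X y) x e)
        = g x • normalPart M x (fderiv ℝ X x e) + (c * ⟪e, x⟫) • X x := by
      rw [h1]
      conv_rhs => rw [← hN]
      simp only [normalPart, map_add, map_smul]
    have h3 : ⟪normalPart M x (fderiv ℝ X x e), X x⟫ = ⟪fderiv ℝ X x e, X x⟫ := by
      conv_rhs => rw [← hN]
      exact Submodule.inner_starProjection_left_eq_right _ _ _
    rw [h2, norm_add_sq_real, norm_smul, norm_smul, inner_smul_left, inner_smul_right, h3]
    simp only [mul_pow, Real.norm_eq_abs, sq_abs, conj_trivial]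
    ring
  have hs1 : ∑ i, ⟪tangentFrame M x i, x⟫ * ⟪fderiv ℝ X x (tangentFrame M x i), X x⟫
      = ⟪fderiv ℝ X x x, X x⟫ := by
    conv_rhs => rw [← sum_inner_tangentFrame hx, map_sum, sum_inner]
    simp [inner_smul_left, sum_inner_tangentFrame hx]
  have hs2 : ∑ i, ⟪tangentFrame M x i, x⟫ ^ 2 = ‖x‖ ^ 2 := by
    rw [sum_inner_sq_tangentFrame, Submodule.starProjection_eq_self_iff.2 hx]
  simp_rw [normalGradSq, hterm, Finset.sum_add_distrib, ← Finset.mul_sum, hs1, hs2]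
  ring

/-! ### Radial weights and the stability inequality -/

section RadialFunctions

variable {u : ℝ → ℝ} {u' : ℝ} {x : E n}

lemma hasFDerivAt_comp_norm (hx : x ≠ 0) (hu : HasDerivAt u u' ‖x‖) :
    HasFDerivAt (fun y : E n => u ‖y‖) ((u' / ‖x‖) • innerSL ℝ x) x := by
  have h1 : HasFDerivAt (fun y : E n => ‖y‖) (‖x‖⁻¹ • innerSL ℝ x) x := by
    have h2 := (hasStrictFDerivAt_norm_sq x).hasFDerivAt.sqrt (by simpa using hx)
    simp only [Real.sqrt_sq (norm_nonneg _)] at h2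
    refine h2.congr_fderiv ?_
    ext1 v
    simp
    field_simp
  refine (hu.comp_hasFDerivAt x h1).congr_fderiv ?_
  rw [smul_smul, div_eq_mul_inv]

lemma contDiffOn_comp_norm {k : WithTop ℕ∞} (hu : ContDiffOn ℝ k u (Ioi 0)) :
    ContDiffOn ℝ k (fun y : E n => u ‖y‖) {0}ᶜ := fun _ hx =>
  ((hu.contDiffAt (Ioi_mem_nhds (norm_pos_iff.2 hx))).comp _
    (contDiffAt_norm ℝ hx)).contDiffWithinAt

lemma contDiff_smul_of_zero_notMem_tsupport {F : Type*} [NormedAddCommGroup F]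
    [NormedSpace ℝ F] {a : E n → ℝ} {Z : E n → F} (ha : ContDiffOn ℝ 1 a {0}ᶜ)
    (hZ : ContDiff ℝ 1 Z) (h0 : (0 : E n) ∉ tsupport Z) : ContDiff ℝ 1 fun x => a x • Z x := by
  refine contDiff_iff_contDiffAt.2 fun x => ?_
  by_cases hx : x = 0
  · subst hx
    have h1 : (fun x => a x • Z x) =ᶠ[𝓝 0] fun _ => 0 := by
      filter_upwards [notMem_tsupport_iff_eventuallyEq.1 h0] with y hy
      rw [hy, Pi.zero_apply, smul_zero]
    exact contDiffAt_const.congr_of_eventuallyEq h1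
  · exact (ha.contDiffAt (isOpen_compl_singleton.mem_nhds hx)).smul hZ.contDiffAt

end RadialFunctions

/-- The profile `w(r) = eʰ h' / r`, for which `w(|x|) x` is the gradient of `exp (h |x|)`. -/
def gradProfile (h : ℝ → ℝ) (t : ℝ) : ℝ := Real.exp (h t) * deriv h t / t

section Weight

variable {h : ℝ → ℝ} {x : E n}

lemma contDiffOn_deriv_Ioi (hh : ContDiffOn ℝ 2 h (Ioi 0)) : ContDiffOn ℝ 1 (deriv h) (Ioi 0) :=
  hh.deriv_of_isOpen isOpen_Ioi (by norm_num)

lemma contDiffOn_gradProfile (hh : ContDiffOn ℝ 2 h (Ioi 0)) :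
    ContDiffOn ℝ 1 (gradProfile h) (Ioi 0) :=
  (((hh.of_le (by norm_num)).exp).mul (contDiffOn_deriv_Ioi hh)).div contDiffOn_id
    fun _ ht => (ne_of_gt ht)

lemma hasDerivAt_of_contDiffOn_Ioi (hh : ContDiffOn ℝ 2 h (Ioi 0)) {t : ℝ} (ht : 0 < t) :
    HasDerivAt h (deriv h t) t :=
  ((hh.contDiffAt (Ioi_mem_nhds ht)).differentiableAt two_ne_zero).hasDerivAt

lemma hasDerivAt_gradProfile (hh : ContDiffOn ℝ 2 h (Ioi 0)) {t : ℝ} (ht : 0 < t) :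
    HasDerivAt (gradProfile h)
      (Real.exp (h t) * (deriv h t ^ 2 + deriv (deriv h) t - deriv h t / t) / t) t := by
  have h1 : HasDerivAt (deriv h) (deriv (deriv h) t) t :=
    (((contDiffOn_deriv_Ioi hh).contDiffAt (Ioi_mem_nhds ht)).differentiableAt
      one_ne_zero).hasDerivAt
  refine (((hasDerivAt_of_contDiffOn_Ioi hh ht).exp.mul h1).div (hasDerivAt_id t)
    ht.ne').congr_deriv ?_
  simp only [id, Pi.mul_apply]
  field_simp

lemma hasFDerivAt_weight (hh : ContDiffOn ℝ 2 h (Ioi 0)) (hx : x ≠ 0) :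
    HasFDerivAt (fun y : E n => Real.exp (h ‖y‖)) (gradProfile h ‖x‖ • innerSL ℝ x) x :=
  hasFDerivAt_comp_norm (u := fun t => Real.exp (h t)) hx
    (hasDerivAt_of_contDiffOn_Ioi hh (norm_pos_iff.2 hx)).exp

lemma hasFDerivAt_sqrt_weight (hh : ContDiffOn ℝ 2 h (Ioi 0)) (hx : x ≠ 0) :
    HasFDerivAt (fun y : E n => Real.exp (h ‖y‖ / 2))
      ((Real.exp (h ‖x‖ / 2) * (deriv h ‖x‖ / 2) / ‖x‖) • innerSL ℝ x) x :=
  hasFDerivAt_comp_norm (u := fun t => Real.exp (h t / 2)) hx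
    ((hasDerivAt_of_contDiffOn_Ioi hh (norm_pos_iff.2 hx)).div_const 2).exp

/-- In directions orthogonal to the radius, the Hessian of the weight is `w(|x|)` times the
Euclidean metric. -/
lemma hessian_weight_apply (hh : ContDiffOn ℝ 2 h (Ioi 0)) (hx : x ≠ 0) {v : E n}
    (hv : ⟪x, v⟫ = 0) :
    fderiv ℝ (fderiv ℝ fun y : E n => Real.exp (h ‖y‖)) x v v = gradProfile h ‖x‖ * ‖v‖ ^ 2 := by
  have h1 : fderiv ℝ (fun y : E n => Real.exp (h ‖y‖))
      =ᶠ[𝓝 x] fun y => gradProfile h ‖y‖ • innerSL ℝ y := by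
    filter_upwards [isOpen_compl_singleton.mem_nhds hx] with y hy
    exact (hasFDerivAt_weight hh hy).fderiv
  have h2 := (hasFDerivAt_comp_norm hx (hasDerivAt_gradProfile hh (norm_pos_iff.2 hx))).smul
    (innerSL ℝ (E := E n)).hasFDerivAt
  rw [h1.fderiv_eq, show fderiv ℝ (fun y : E n => gradProfile h ‖y‖ • innerSL ℝ y) x = _ from
    h2.fderiv]
  simp only [add_apply, smul_apply, ContinuousLinearMap.smulRight_apply, innerSL_apply_apply, hv,
    smul_eq_mul, mul_zero, zero_mul, add_zero]
  exact congrArg _ (real_inner_self_eq_norm_sq v)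

lemma fderiv_gradProfile_mul_apply_self (hh : ContDiffOn ℝ 2 h (Ioi 0)) (hx : x ≠ 0)
    {X : E n → E n} (hX : DifferentiableAt ℝ X x) :
    fderiv ℝ (fun y => gradProfile h ‖y‖ * (‖X y‖ ^ 2 / 2)) x x
      = gradProfile h ‖x‖ * ⟪fderiv ℝ X x x, X x⟫ + Real.exp (h ‖x‖) * (deriv h ‖x‖ ^ 2
          + deriv (deriv h) ‖x‖ - deriv h ‖x‖ / ‖x‖) * (‖X x‖ ^ 2 / 2) := by
  have hr : 0 < ‖x‖ := norm_pos_iff.2 hx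
  have h1 := (hasFDerivAt_comp_norm hx (hasDerivAt_gradProfile hh hr)).mul
    (hX.hasFDerivAt.norm_sq.mul_const (2⁻¹ : ℝ))
  have h2 : fderiv ℝ (fun y => gradProfile h ‖y‖ * (‖X y‖ ^ 2 / 2)) x = _ := h1.fderiv
  rw [h2]
  simp only [add_apply, smul_apply, ContinuousLinearMap.comp_apply, innerSL_apply_apply,
    smul_eq_mul, real_inner_self_eq_norm_sq, real_inner_comm]
  field_simp
  ring


end Weight

/-- The comparison of the integrands of the gradient terms, with `r = |x|`, `p = h'`, `s = h''`,
`N = |X|²`, `D = ⟨D_x X, X⟩`, `f = eʰ = g²`, and `Q` the gradient term of `X`. -/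
lemma gradient_term_le {r p s N D g f Q m : ℝ} (hr : 0 < r) (hN : 0 ≤ N) (hgf : g ^ 2 = f)
    (h : 0 ≤ r * p ^ 2 + 2 * r * s + 2 * m * p) :
    g ^ 2 * Q + 2 * g * (g * (p / 2) / r) * D + (g * (p / 2) / r) ^ 2 * r ^ 2 * N
      ≤ f * Q + f * p / r * N
        + (f * p / r * D + f * (p ^ 2 + s - p / r) * (N / 2) + (m - 1) * (f * p / r * (N / 2))) := by
  subst hgf
  have h1 : 0 ≤ N * g ^ 2 / (4 * r) * (r * p ^ 2 + 2 * r * s + 2 * m * p) := by positivity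
  have h2 : g ^ 2 * Q + g ^ 2 * p / r * N
        + (g ^ 2 * p / r * D + g ^ 2 * (p ^ 2 + s - p / r) * (N / 2)
          + (m - 1) * (g ^ 2 * p / r * (N / 2)))
      - (g ^ 2 * Q + 2 * g * (g * (p / 2) / r) * D + (g * (p / 2) / r) ^ 2 * r ^ 2 * N)
      = N * g ^ 2 / (4 * r) * (r * p ^ 2 + 2 * r * s + 2 * m * p) := by
    field_simp
    ring
  linarith

section Stability

variable {h : ℝ → ℝ} {X : E n → E n} {U : Set (E n)}

/-- The radial potential `½ w(|x|) |X|²`, whose radial divergence compares the two gradient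
terms. -/
def radialPotential (h : ℝ → ℝ) (X : E n → E n) (x : E n) : ℝ :=
  gradProfile h ‖x‖ * (‖X x‖ ^ 2 / 2)

lemma support_radialPotential_subset :
    Function.support (radialPotential h X) ⊆ Function.support X :=
  fun x hx h0 => hx (by simp [radialPotential, h0])

lemma contDiff_radialPotential (hh : ContDiffOn ℝ 2 h (Ioi 0)) (hX : ContDiff ℝ 1 X)
    (hX0 : (0 : E n) ∉ tsupport X) : ContDiff ℝ 1 (radialPotential h X) := by
  have hZs : Function.support (fun x => ‖X x‖ ^ 2 / 2) ⊆ Function.support X := fun x hx h0 =>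
    hx (by simp [h0])
  exact contDiff_smul_of_zero_notMem_tsupport (contDiffOn_comp_norm (contDiffOn_gradProfile hh))
    ((hX.norm_sq ℝ).div_const 2) fun h0 => hX0 (closure_mono hZs h0)

lemma contDiff_sqrt_weight_smul (hh : ContDiffOn ℝ 2 h (Ioi 0)) (hX : ContDiff ℝ 1 X)
    (hX0 : (0 : E n) ∉ tsupport X) : ContDiff ℝ 1 fun y => Real.exp (h ‖y‖ / 2) • X y :=
  contDiff_smul_of_zero_notMem_tsupport
    (contDiffOn_comp_norm (u := fun t => Real.exp (h t / 2))
      ((hh.of_le (by norm_num)).div_const 2).exp) hX hX0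

lemma exp_half_sq (a : ℝ) : Real.exp (a / 2) ^ 2 = Real.exp a := by
  rw [← Real.exp_nat_mul]
  congr 1
  push_cast
  ring

/-- Multiplying a variation field by the square root of the weight gives a variation field. -/
lemma IsNormalVariation.sqrt_weight_smul (hX : IsNormalVariation M U X)
    (hh : ContDiffOn ℝ 2 h (Ioi 0)) (hU0 : (0 : E n) ∉ U) :
    IsNormalVariation M U fun y => Real.exp (h ‖y‖ / 2) • X y := by
  have hs : Function.support (fun y => Real.exp (h ‖y‖ / 2) • X y) ⊆ Function.support X :=
    fun x hx h0 => hx (by simp [h0])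
  exact ⟨contDiff_sqrt_weight_smul hh hX.contDiff fun h0 => hU0 (hX.tsupport_subset h0),
    hX.hasCompactSupport.mono hs, (closure_mono hs).trans hX.tsupport_subset,
    fun x hx => Submodule.smul_mem _ _ (hX.normal x hx)⟩

lemma IsNormalVariation.integrableOn_normalGradSq (hX : IsNormalVariation M U X)
    (hM : IsC2Hypersurface M) (hUM : Disjoint U (closure M \ M)) :
    IntegrableOn (normalGradSq M X) M μHE[n - 1] :=
  hM.integrableOn_of_continuousOn hUM hX.hasCompactSupport hX.tsupport_subset
    (hM.continuousOn_normalGradSq hX.contDiff) fun _ _ hx => normalGradSq_eq_zero hx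

lemma IsNormalVariation.inner_self_eq_zero (hX : IsNormalVariation M U X)
    (hcone : ∀ x ∈ M, ∀ t : ℝ, 0 < t → t • x ∈ M) {x : E n} (hx : x ∈ M) : ⟪x, X x⟫ = 0 :=
  hX.normal x hx x (mem_tangentSpace_self hcone hx)

lemma IsNormalVariation.integrableOn_weighted (hX : IsNormalVariation M U X)
    (hh : ContDiffOn ℝ 2 h (Ioi 0)) (hM : IsC2Hypersurface M) (hM0 : (0 : E n) ∉ M)
    (hcone : ∀ x ∈ M, ∀ t : ℝ, 0 < t → t • x ∈ M) (hUM : Disjoint U (closure M \ M)) :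
    IntegrableOn (fun x => Real.exp (h ‖x‖) * normalGradSq M X x
      + fderiv ℝ (fderiv ℝ fun y : E n => Real.exp (h ‖y‖)) x (X x) (X x)) M μHE[n - 1] := by
  have hne : ∀ x ∈ M, x ≠ 0 := fun x hx h0 => hM0 (h0 ▸ hx)
  have hfc : ContinuousOn (fun x : E n => Real.exp (h ‖x‖)) M := fun x hx =>
    (hasFDerivAt_weight hh (hne x hx)).continuousAt.continuousWithinAt
  have hwc : ContinuousOn (fun x : E n => gradProfile h ‖x‖) M :=
    (contDiffOn_comp_norm (contDiffOn_gradProfile hh)).continuousOn.mono hne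
  have hcont : ContinuousOn (fun x => Real.exp (h ‖x‖) * normalGradSq M X x
      + gradProfile h ‖x‖ * ‖X x‖ ^ 2) M :=
    (hfc.mul (hM.continuousOn_normalGradSq hX.contDiff)).add
      (hwc.mul (hX.contDiff.continuous.norm.pow 2).continuousOn)
  have h1 : IntegrableOn (fun x => Real.exp (h ‖x‖) * normalGradSq M X x
      + gradProfile h ‖x‖ * ‖X x‖ ^ 2) M μHE[n - 1] := by
    refine hM.integrableOn_of_continuousOn hUM hX.hasCompactSupport hX.tsupport_subset hcont ?_
    intro x _ hx
    simp [normalGradSq_eq_zero hx, image_eq_zero_of_notMem_tsupport hx]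
  refine h1.congr_fun (fun x hx => ?_) hM.measurableSet
  simp only [hessian_weight_apply hh (hne x hx) (hX.inner_self_eq_zero hcone hx)]

/-- The pointwise comparison of the gradient terms, up to a radial divergence. -/
lemma IsNormalVariation.normalGradSq_sqrt_weight_smul_le (hn : 1 ≤ n)
    (hX : IsNormalVariation M U X) (hh : ContDiffOn ℝ 2 h (Ioi 0))
    (hineq : ∀ t : ℝ, 0 < t →
      0 ≤ t * (deriv h t) ^ 2 + 2 * t * deriv (deriv h) t + 2 * (n : ℝ) * deriv h t)
    (hcone : ∀ x ∈ M, ∀ t : ℝ, 0 < t → t • x ∈ M) {x : E n} (hx : x ∈ M) (hx0 : x ≠ 0) :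
    normalGradSq M (fun y => Real.exp (h ‖y‖ / 2) • X y) x
      ≤ (Real.exp (h ‖x‖) * normalGradSq M X x
          + fderiv ℝ (fderiv ℝ fun y : E n => Real.exp (h ‖y‖)) x (X x) (X x))
        + (fderiv ℝ (radialPotential h X) x x + (n - 1 : ℕ) * radialPotential h X x) := by
  have hXd := hX.contDiff.differentiable one_ne_zero x
  have e2 : fderiv ℝ (radialPotential h X) x x = _ := fderiv_gradProfile_mul_apply_self hh hx0 hXd
  have e3 : ((n - 1 : ℕ) : ℝ) = n - 1 := by push_cast [hn]; ring
  rw [normalGradSq_smul (mem_tangentSpace_self hcone hx) (hasFDerivAt_sqrt_weight hh hx0) hXd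
    (hX.normal x hx), e2, e3, hessian_weight_apply hh hx0 (hX.inner_self_eq_zero hcone hx)]
  exact gradient_term_le (norm_pos_iff.2 hx0) (sq_nonneg _) (exp_half_sq _)
    (hineq _ (norm_pos_iff.2 hx0))

/-- The stability inequality. With `X` replaced by `exp (h / 2) X`, the stability inequality for the
area produces the curvature terms of the weighted one; the difference of the gradient terms is, up
to the divergence of `½ w |X|² x`, which integrates to zero, `-½ f |X|²` times
`h'² / 2 + h'' + n h' / r ≥ 0`. -/
lemma stability_inequality (hn : 1 ≤ n) (hh : ContDiffOn ℝ 2 h (Ioi 0))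
    (hineq : ∀ t : ℝ, 0 < t →
      0 ≤ t * (deriv h t) ^ 2 + 2 * t * deriv (deriv h) t + 2 * (n : ℝ) * deriv h t)
    (hM : IsC2Hypersurface M) (hM0 : (0 : E n) ∉ M)
    (hcone : ∀ x ∈ M, ∀ t : ℝ, 0 < t → t • x ∈ M) (hU : IsOpen U)
    (hUM : Disjoint U (closure M \ M)) (hU0 : (0 : E n) ∉ U) (hst : IsStableMinimal M U)
    (hX : IsNormalVariation M U X) :
    ∫ x in M, Real.exp (h ‖x‖) *
        ((∑ i, ∑ j, ⟪secondFundamentalForm M x (tangentFrame M x i) (tangentFrame M x j), X x⟫ ^ 2)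
          + ⟪meanCurvature M x, X x⟫ ^ 2) ∂μHE[n - 1]
      ≤ ∫ x in M, (Real.exp (h ‖x‖) * normalGradSq M X x
          + fderiv ℝ (fderiv ℝ fun y => Real.exp (h ‖y‖)) x (X x) (X x)) ∂μHE[n - 1] := by
  have hvar := hX.sqrt_weight_smul hh hU0
  have hrad := integral_radial_deriv hM hcone hU hUM
    (contDiff_radialPotential hh hX.contDiff fun h0 => hU0 (hX.tsupport_subset h0))
    (hX.hasCompactSupport.mono support_radialPotential_subset)
    ((closure_mono support_radialPotential_subset).trans hX.tsupport_subset)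
  have hint := hX.integrableOn_weighted hh hM hM0 hcone hUM
  have hstab := hst.stability _ hvar
  have hL : ∀ x, (1 : ℝ) * ((∑ i, ∑ j, ⟪secondFundamentalForm M x (tangentFrame M x i)
        (tangentFrame M x j), Real.exp (h ‖x‖ / 2) • X x⟫ ^ 2)
          + ⟪meanCurvature M x, Real.exp (h ‖x‖ / 2) • X x⟫ ^ 2)
      = Real.exp (h ‖x‖) * ((∑ i, ∑ j, ⟪secondFundamentalForm M x (tangentFrame M x i)
        (tangentFrame M x j), X x⟫ ^ 2) + ⟪meanCurvature M x, X x⟫ ^ 2) := by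
    intro x
    simp only [inner_smul_right, mul_pow, ← Finset.mul_sum, exp_half_sq]
    ring
  have hR : ∀ x, (1 : ℝ) * (∑ i, ‖normalPart M x
        (fderiv ℝ (fun y => Real.exp (h ‖y‖ / 2) • X y) x (tangentFrame M x i))‖ ^ 2)
      + fderiv ℝ (fderiv ℝ fun _ : E n => (1 : ℝ)) x (Real.exp (h ‖x‖ / 2) • X x)
        (Real.exp (h ‖x‖ / 2) • X x)
      = normalGradSq M (fun y => Real.exp (h ‖y‖ / 2) • X y) x := by
    intro x
    simp [normalGradSq]
  simp only [hL, hR] at hstab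
  refine hstab.trans ((setIntegral_mono_on (hvar.integrableOn_normalGradSq hM hUM)
    (hint.add hrad.1) hM.measurableSet fun x hx => hX.normalGradSq_sqrt_weight_smul_le hn hh hineq
      hcone hx fun h0 => hM0 (h0 ▸ hx)).trans_eq ?_)
  simp only [Pi.add_apply]
  rw [integral_add hint hrad.1, hrad.2, add_zero]

end Stability

lemma smul_mem_cone {S : Set (E n)} {x : E n} (hx : x ∈ cone S \ {0}) {t : ℝ} (ht : 0 < t) :
    t • x ∈ cone S \ {0} := by
  obtain ⟨⟨s, hs, y, hy, rfl⟩, h0⟩ := hx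
  exact ⟨⟨t * s, by positivity, y, hy, smul_smul t s y⟩, smul_ne_zero ht.ne' h0⟩

lemma zero_mem_closure_of_nonempty (hcone : ∀ x ∈ M, ∀ t : ℝ, 0 < t → t • x ∈ M)
    (hne : M.Nonempty) : (0 : E n) ∈ closure M := by
  obtain ⟨x, hx⟩ := hne
  have h1 : Tendsto (fun t : ℝ => t • x) (𝓝[>] 0) (𝓝 0) := by
    have : Continuous fun t : ℝ => t • x := by fun_prop
    simpa using this.continuousWithinAt (s := Ioi 0) (x := 0) |>.tendsto
  refine mem_closure_of_tendsto h1 ?_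
  filter_upwards [self_mem_nhdsWithin] with t ht
  exact hcone x hx t ht

lemma isFStable_empty (f : E n → ℝ) (U : Set (E n)) : IsFStable f ∅ U where
  stationary K ε φ _ _ _ _ := by
    simpa [weightedArea] using hasDerivAt_const (0 : ℝ) (0 : ℝ)
  stability X _ := by simp

end WeightedArea

end

theorem theorem1p8 (n : ℕ) (hn : 2 ≤ n) (h : ℝ → ℝ)
    (hh : ContDiffOn ℝ 2 h (Set.Ioi 0))
    (hineq : ∀ t : ℝ, 0 < t →
      0 ≤ t * (deriv h t) ^ 2 + 2 * t * deriv (deriv h) t + 2 * (n : ℝ) * deriv h t)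
    (hint : ∀ r : ℝ, 0 < r →
      MeasureTheory.IntegrableOn (fun t : ℝ => Real.exp (h t) * t ^ (n - 2)) (Set.Ioo 0 r))
    (S : Set (WeightedArea.E n)) (hS : S ⊆ Metric.sphere 0 1)
    (hC : WeightedArea.IsC2Hypersurface (WeightedArea.cone S \ {0}))
    (hor : WeightedArea.IsOrientable (WeightedArea.cone S \ {0}))
    (U : Set (WeightedArea.E n)) (hU : IsOpen U)
    (hUC : Disjoint U
      (closure (WeightedArea.cone S \ {0}) \ (WeightedArea.cone S \ {0})))
    (hstable : WeightedArea.IsStableMinimal (WeightedArea.cone S \ {0}) U) :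
    WeightedArea.IsFStable (fun x => Real.exp (h ‖x‖)) (WeightedArea.cone S \ {0}) U := by
  have hcone : ∀ x ∈ WeightedArea.cone S \ {0}, ∀ t : ℝ, 0 < t →
      t • x ∈ WeightedArea.cone S \ {0} := fun x hx t ht => WeightedArea.smul_mem_cone hx ht
  have hM0 : (0 : WeightedArea.E n) ∉ WeightedArea.cone S \ {0} := fun h0 => h0.2 rfl
  -- a nonempty cone accumulates at its vertex, which keeps `U` away from it; the empty one does not
  rcases (WeightedArea.cone S \ {0}).eq_empty_or_nonempty with he | hne
  · rw [he]
    exact WeightedArea.isFStable_empty _ _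
  have hU0 : (0 : WeightedArea.E n) ∉ U := fun h0 =>
    hUC.le_bot ⟨h0, WeightedArea.zero_mem_closure_of_nonempty hcone hne, hM0⟩
  have hf : ContDiffOn ℝ 2 (fun x : WeightedArea.E n => Real.exp (h ‖x‖)) {0}ᶜ :=
    WeightedArea.contDiffOn_comp_norm (u := fun t => Real.exp (h t)) hh.exp
  refine ⟨hstable.stationary.of_area hC hU hUC (hf.mono fun x hx h0 => hU0 (h0 ▸ hx)) ?_,
    fun X hX => WeightedArea.stability_inequality (by omega) hh hineq hC hM0 hcone hU hUC hU0
      hstable hX⟩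
  intro x hx v hv
  rw [(WeightedArea.hasFDerivAt_weight hh hx.1.2).fderiv]
  have h1 := hv x (WeightedArea.mem_tangentSpace_self hcone hx.1)
  simp [h1]
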